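/- Let $k$ be a commutative ring. A *bicomplex* $X$ consists of $k$-modules $X_{p,q}$ ($p,q\in\mathbb Z$, with $X_{p,q}=0$ for $p<0$) and differentials $d_h\colon X_{p,q}\to X_{p-1,q}$, $d_v\colon X_{p,q}\to X_{p,q-1}$ with $d_h^2=0$, $d_v^2=0$, $d_vd_h+d_hd_v=0$; morphisms are the families of $k$-linear maps $X_{p,q}\to Y_{p,q}$ commuting with $d_h$ and $d_v$. Let $\operatorname{bCh}$ be the category of bicomplexes, $H^v_{p,q}(X)$ the homology of $(X_{p,*},d_v)$ in degree $q$, and $\operatorname{Tot}(X)$ the chain complex $\operatorname{Tot}_n(X)=\bigoplus_{p+q=n}X_{p,q}$ with differential $d_h+d_v$. For $p>0$ and $q\in\mathbb Z$ let $D^{p,q}$ be the bicomplex with $k$ in bidegrees $(p,q),(p-1,q),(p,q-1),(p-1,q-1)$ and $0$ elsewhere, whose four nontrivial differentials are identities, except for $d_v=-1\colon D^{p,q}_{p,q}\to D^{p,q}_{p,q-1}$. Let $\partial_hD^{p,q}$ and $\partial_vD^{p,q}$ be its sub-bicomplexes of horizontal and vertical boundaries (the images of $d_h$ and $d_v$):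 they are $k$ in bidegrees $(p-1,q),(p-1,q-1)$, respectively $(p,q-1),(p-1,q-1)$. Let $S^{p,q}$ be $k$ concentrated in bidegree $(p,q)$. Set $$I_{\operatorname{Tot}}=\{S^{0,q-1}\hookrightarrow\partial_hD^{1,q}\}_{q\in\mathbb Z}\cup\{\partial_vD^{p,q}\hookrightarrow D^{p,q}\}_{p>0,\,q\in\mathbb Z},$$ $$J_{\operatorname{Tot}}=\{0\hookrightarrow\partial_hD^{1,q}\}_{q\in\mathbb Z}\cup\{\partial_vD^{p,q}\hookrightarrow D^{p,q}\}_{p>0,\,q\in\mathbb Z}.$$ **Theorem 3.1.** The category $\operatorname{bCh}$ is abelian, has all small limits and colimits, and carries a proper, combinatorial, abelian model structure (the *total model structure*) such that: - a morphism $f$ is a weak equivalence if and only if $\operatorname{Tot}(f)$ is a quasi-isomorphism; - a morphism $f$ is a fibration (resp. a trivial fibration) if and only if it is surjective in every bidegree and $H^v_{p,q}(f)$ is an isomorphism for all $q\in\mathbb Z$ and all $p>0$ (resp. all $p\ge 0$); - a morphism is a cofibration if and only if it is injective with cofibrant cokernel; and every cofibrant bicomplex is projective as a $k$-module in every bidegree;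 - it is cofibrantly generated, with set of generating cofibrations $I_{\operatorname{Tot}}$ and set of generating trivial cofibrations $J_{\operatorname{Tot}}$. Here *proper* means that weak equivalences are stable under pushout along cofibrations and under pullback along fibrations; *cofibrantly generated* with generating sets $I$, $J$ means that $I$ and $J$ permit the small object argument, the fibrations are the maps with the right lifting property with respect to $J$, and the trivial fibrations are those with the right lifting property with respect to $I$; *combinatorial* means cofibrantly generated and locally presentable; and *abelian* means that the (trivial) cofibrations are the monomorphisms with (trivially) cofibrant cokernel and the (trivial) fibrations are the epimorphisms with (trivially) fibrant kernel, an object $X$ being trivially cofibrant (resp. trivially fibrant) if it is cofibrant (resp. fibrant) and $0\to X$ (resp. $X\to 0$) is a weak equivalence. -/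

import Mathlib

open CategoryTheory CategoryTheory.Limits HomotopicalAlgebra
open scoped DirectSum

universe u

/-- A (right half-plane) bicomplex of `k`-modules. The module in bidegree `(p, q)`, with `p : ℕ` and
`q : ℤ`, is `(col p).X q`; there is nothing in negative horizontal degree, so that `dh` is zero on
horizontal degree `0`. The `p`-th column with its vertical differential `d_v` is the chain complex
`col p`. The differentials anticommute. -/
structure BCh (k : Type u) [CommRing k] where
  col : ℕ → ChainComplex (ModuleCat.{u} k) ℤ
  dh (p : ℕ) (q : ℤ) : (col (p + 1)).X q ⟶ (col p).X q
  dh_comp_dh (p : ℕ) (q : ℤ) : dh (p + 1) q ≫ dh p q = 0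
  anticomm (p : ℕ) (q q' : ℤ) :
    dh p q ≫ (col p).d q q' + (col (p + 1)).d q q' ≫ dh p q' = 0

namespace BCh

variable {k : Type u} [CommRing k]

/-- Morphisms of bicomplexes: bidegreewise maps compatible with both differentials. -/
@[ext]
structure Hom (X Y : BCh k) where
  f (p : ℕ) : X.col p ⟶ Y.col p
  comm (p : ℕ) (q : ℤ) : X.dh p q ≫ (f p).f q = (f (p + 1)).f q ≫ Y.dh p q

instance : Category (BCh k) where
  Hom X Y := Hom X Y
  id X := ⟨fun p => 𝟙 (X.col p), fun p q => by simp⟩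
  comp {X Y Z} φ ψ := ⟨fun p => φ.f p ≫ ψ.f p, fun p q => by
    have h1 := φ.comm p q
    have h2 := ψ.comm p q
    simp only [HomologicalComplex.comp_f, Category.assoc, ← h2]
    simp only [← Category.assoc, h1]⟩

@[simp]
theorem id_f (X : BCh k) (p : ℕ) : Hom.f (𝟙 X) p = 𝟙 (X.col p) := rfl

@[simp]
theorem comp_f {X Y Z : BCh k} (φ : X ⟶ Y) (ψ : Y ⟶ Z) (p : ℕ) :
    Hom.f (φ ≫ ψ) p = Hom.f φ p ≫ Hom.f ψ p := rfl

@[ext]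
theorem hom_ext {X Y : BCh k} (φ ψ : X ⟶ Y) (h : ∀ p q, (Hom.f φ p).f q = (Hom.f ψ p).f q) :
    φ = ψ := by
  apply Hom.ext
  funext p
  ext1 q
  exact h p q

/-- The component `X_{p,q} → Y_{p,q}` of a morphism. -/
abbrev app {X Y : BCh k} (φ : X ⟶ Y) (p : ℕ) (q : ℤ) : (X.col p).X q ⟶ (Y.col p).X q :=
  (Hom.f φ p).f q

/-- The map `H^v_{p,q}(φ)` induced on vertical homology. -/
noncomputable abbrev vHomologyMap {X Y : BCh k} (φ : X ⟶ Y) (p : ℕ) (q : ℤ) :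
    (X.col p).homology q ⟶ (Y.col p).homology q :=
  HomologicalComplex.homologyMap (Hom.f φ p) q

/-! ### The total complex -/

/-- The bidegrees of total degree `n`. -/
abbrev TotIdx (n : ℤ) : Type := {i : ℕ × ℤ // (i.1 : ℤ) + i.2 = n}

/-- `Tot_n(X) = ⨁_{p+q=n} X_{p,q}`. -/
abbrev TotX (X : BCh k) (n : ℤ) : Type u := ⨁ i : TotIdx n, (X.col i.1.1).X i.1.2

/-- The horizontal differential on a summand of the total complex. -/
noncomputable def totDh (X : BCh k) (n n' : ℤ) (h : n' + 1 = n) :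
    ∀ i : TotIdx n, (X.col i.1.1).X i.1.2 →ₗ[k] X.TotX n'
  | ⟨(0, _), _⟩ => 0
  | ⟨(p + 1, q), hi⟩ =>
      DirectSum.lof k (TotIdx n') (fun i => (X.col i.1.1).X i.1.2)
        ⟨(p, q), by push_cast at hi ⊢; linarith⟩ ∘ₗ (X.dh p q).hom

/-- The vertical differential on a summand of the total complex. -/
noncomputable def totDv (X : BCh k) (n n' : ℤ) (h : n' + 1 = n) (i : TotIdx n) :
    (X.col i.1.1).X i.1.2 →ₗ[k] X.TotX n' :=
  DirectSum.lof k (TotIdx n') (fun i => (X.col i.1.1).X i.1.2)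
    ⟨(i.1.1, i.1.2 - 1), by have := i.2; dsimp only; linarith⟩ ∘ₗ
      ((X.col i.1.1).d i.1.2 (i.1.2 - 1)).hom

/-- The differential `d_h + d_v` of the total complex. -/
noncomputable def totD (X : BCh k) (n n' : ℤ) : X.TotX n →ₗ[k] X.TotX n' :=
  if h : n' + 1 = n then
    DirectSum.toModule k (TotIdx n) (X.TotX n') fun i => X.totDh n n' h i + X.totDv n n' h i
  else 0

theorem totD_lof (X : BCh k) (n n' : ℤ) (h : n' + 1 = n) (i : TotIdx n)
    (x : (X.col i.1.1).X i.1.2) :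
    X.totD n n' (DirectSum.lof k (TotIdx n) (fun i => (X.col i.1.1).X i.1.2) i x) =
      X.totDh n n' h i x + X.totDv n n' h i x := by
  rw [totD, dif_pos h, DirectSum.toModule_lof, LinearMap.add_apply]

theorem totD_comp (X : BCh k) (n n' n'' : ℤ) : X.totD n' n'' ∘ₗ X.totD n n' = 0 := by
  by_cases h : n' + 1 = n
  swap
  · rw [totD.eq_def X n n', dif_neg h, LinearMap.comp_zero]
  by_cases h' : n'' + 1 = n'
  swap
  · rw [totD.eq_def X n' n'', dif_neg h', LinearMap.zero_comp]
  refine DirectSum.linearMap_ext k fun i => LinearMap.ext fun x => ?_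
  rw [LinearMap.comp_apply, LinearMap.comp_apply, totD_lof X n n' h, map_add]
  have hvv (p : ℕ) (q : ℤ) (x : (X.col p).X q) :
      ((X.col p).d (q - 1) (q - 1 - 1)).hom (((X.col p).d q (q - 1)).hom x) = 0 :=
    congrArg (fun g => g.hom x) ((X.col p).d_comp_d q (q - 1) (q - 1 - 1))
  have hhh (p : ℕ) (q : ℤ) (x : (X.col (p + 1 + 1)).X q) :
      (X.dh p q).hom ((X.dh (p + 1) q).hom x) = 0 :=
    congrArg (fun g => g.hom x) (X.dh_comp_dh p q)
  have hvh (p : ℕ) (q : ℤ) (x : (X.col (p + 1)).X q) :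
      ((X.col p).d q (q - 1)).hom ((X.dh p q).hom x) +
        (X.dh p (q - 1)).hom (((X.col (p + 1)).d q (q - 1)).hom x) = 0 :=
    congrArg (fun g => g.hom x) (X.anticomm p q (q - 1))
  rcases i with ⟨⟨_ | _ | p, q⟩, hi⟩
  · simp only [totDh, totDv, LinearMap.comp_apply, LinearMap.zero_apply, map_zero, zero_add,
      totD_lof X n' n'' h', hvv]
  · simp only [totDh, totDv, LinearMap.comp_apply, LinearMap.zero_apply, zero_add,
      totD_lof X n' n'' h', hvv, map_zero, add_zero]
    rw [← map_add, hvh, map_zero]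
  · simp only [totDh, totDv, LinearMap.comp_apply, LinearMap.zero_apply, zero_add,
      totD_lof X n' n'' h', hvv, hhh, map_zero, add_zero]
    rw [← map_add, hvh, map_zero]

/-- The map `Tot_n(X) → Tot_n(Y)` induced by a morphism. -/
noncomputable def totMap {X Y : BCh k} (φ : X ⟶ Y) (n : ℤ) : X.TotX n →ₗ[k] Y.TotX n :=
  DirectSum.lmap fun i : TotIdx n => (app φ i.1.1 i.1.2).hom

theorem totMap_lof {X Y : BCh k} (φ : X ⟶ Y) (n : ℤ) (i : TotIdx n) (x : (X.col i.1.1).X i.1.2) :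
    totMap φ n (DirectSum.lof k (TotIdx n) (fun i => (X.col i.1.1).X i.1.2) i x) =
      DirectSum.lof k (TotIdx n) (fun i => (Y.col i.1.1).X i.1.2) i
        ((app φ i.1.1 i.1.2).hom x) :=
  DirectSum.lmap_lof _ _ _

theorem totMap_comm {X Y : BCh k} (φ : X ⟶ Y) (n n' : ℤ) :
    Y.totD n n' ∘ₗ totMap φ n = totMap φ n' ∘ₗ X.totD n n' := by
  by_cases h : n' + 1 = n
  swap
  · rw [totD, totD, dif_neg h, dif_neg h, LinearMap.comp_zero, LinearMap.zero_comp]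
  refine DirectSum.linearMap_ext k fun i => LinearMap.ext fun x => ?_
  simp only [LinearMap.comp_apply]
  rw [totMap_lof, totD_lof _ n n' h, totD_lof _ n n' h, map_add]
  have hv (p : ℕ) (q : ℤ) (x : (X.col p).X q) :
      ((Y.col p).d q (q - 1)).hom ((app φ p q).hom x) =
        (app φ p (q - 1)).hom (((X.col p).d q (q - 1)).hom x) :=
    congrArg (fun g => g.hom x) ((Hom.f φ p).comm q (q - 1))
  have hh (p : ℕ) (q : ℤ) (x : (X.col (p + 1)).X q) :
      (Y.dh p q).hom ((app φ (p + 1) q).hom x) = (app φ p q).hom ((X.dh p q).hom x) :=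
    (congrArg (fun g => g.hom x) (Hom.comm φ p q)).symm
  rcases i with ⟨⟨_ | p, q⟩, hi⟩
  · simp only [totDh, totDv, LinearMap.comp_apply, LinearMap.zero_apply, map_zero, zero_add, hv]
    exact (totMap_lof φ n' ⟨(0, q - 1), _⟩ _).symm
  · simp only [totDh, totDv, LinearMap.comp_apply, hv, hh]
    exact congrArg₂ (· + ·) (totMap_lof φ n' ⟨(p, q), _⟩ _).symm
      (totMap_lof φ n' ⟨(p + 1, q - 1), _⟩ _).symm

/-- The totalisation functor. -/
noncomputable def Tot : BCh k ⥤ ChainComplex (ModuleCat.{u} k) ℤ where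
  obj X :=
    { X := fun n => ModuleCat.of k (X.TotX n)
      d := fun n n' => ModuleCat.ofHom (X.totD n n')
      shape := fun n n' h => by
        have h' : ¬ n' + 1 = n := h
        rw [totD, dif_neg h']
        rfl
      d_comp_d' := fun n n' n'' _ _ => by
        rw [← ModuleCat.ofHom_comp, totD_comp]
        rfl }
  map φ :=
    { f := fun n => ModuleCat.ofHom (totMap φ n)
      comm' := fun n n' _ => by
        rw [← ModuleCat.ofHom_comp, ← ModuleCat.ofHom_comp, totMap_comm] }
  map_id X := by
    ext n : 2
    refine DirectSum.linearMap_ext k fun i => LinearMap.ext fun x => ?_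
    exact totMap_lof (𝟙 X) n i x
  map_comp φ ψ := by
    ext n : 2
    refine DirectSum.linearMap_ext k fun i => LinearMap.ext fun x => ?_
    refine (totMap_lof (φ ≫ ψ) n i x).trans ?_
    exact ((congrArg _ (totMap_lof φ n i x)).trans (totMap_lof ψ n i _)).symm

/-! ### Spheres, discs and their boundaries -/

variable (k) in
/-- The module `k` if `P` holds, and `0` otherwise (as a submodule of `k`). -/
def cell (P : Prop) : Submodule k k where
  carrier := {x | P ∨ x = 0}
  add_mem' := by
    rintro a b (h | rfl) (h' | rfl)
    · exact Or.inl h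
    · exact Or.inl h
    · exact Or.inl h'
    · exact Or.inr (add_zero 0)
  zero_mem' := Or.inr rfl
  smul_mem' := by
    rintro c x (h | rfl)
    · exact Or.inl h
    · exact Or.inr (smul_zero c)

open Classical in
/-- Multiplication by `c`, as a map between two modules each of which is `k` or `0`. -/
noncomputable def cellMap (P Q : Prop) (c : k) : cell k P →ₗ[k] cell k Q where
  toFun x := ⟨if Q then c * x else 0, by
    by_cases h : Q
    · exact Or.inl h
    · exact Or.inr (if_neg h)⟩
  map_add' x y := by
    ext
    by_cases h : Q <;> simp [h, mul_add]
  map_smul' r x := by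
    ext
    by_cases h : Q <;> simp [h, mul_left_comm]

theorem cellMap_comp {P Q R : Prop} (h : P → R → Q) (c c' : k) :
    cellMap Q R c' ∘ₗ cellMap P Q c = cellMap P R (c' * c) := by
  ext ⟨x, hx⟩
  rcases hx with hP | rfl
  · by_cases hR : R
    · have hQ := h hP hR
      simp [cellMap, hQ, hR, mul_assoc]
    · simp [cellMap, hR]
  · simp [cellMap]

theorem cellMap_eq_zero {P Q : Prop} (h : ¬ (P ∧ Q)) (c : k) : cellMap P Q c = 0 := by
  ext ⟨x, hx⟩
  rcases hx with hP | rfl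
  · have hQ : ¬ Q := fun hQ => h ⟨hP, hQ⟩
    simp [cellMap, hQ]
  · simp [cellMap]

theorem cellMap_comp_eq_zero {P Q R : Prop} (h : ¬ (P ∧ Q ∧ R)) (c c' : k) :
    cellMap Q R c' ∘ₗ cellMap P Q c = 0 := by
  by_cases hQ : Q
  · rw [cellMap_comp (fun _ _ => hQ), cellMap_eq_zero (fun hh => h ⟨hh.1, hQ, hh.2⟩)]
  · rw [cellMap_eq_zero (P := P) (fun hh => hQ hh.2), LinearMap.comp_zero]

theorem cell_mono {P Q : Prop} (h : P → Q) : cell k P ≤ cell k Q :=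
  fun _ hx => Or.imp h id hx

theorem cellMap_inclusion {P P' Q Q' : Prop} (h : P → Q) (h' : P' → Q') (hPQ : P → Q' → P')
    (c : k) : cellMap Q Q' c ∘ₗ Submodule.inclusion (cell_mono h) =
      Submodule.inclusion (cell_mono h') ∘ₗ cellMap P P' c := by
  ext ⟨x, hx⟩
  rcases hx with hP | rfl
  · by_cases hQ : Q'
    · simp [cellMap, hQ, hPQ hP hQ]
    · have hP' : ¬ P' := fun hh => hQ (h' hh)
      simp [cellMap, hQ, hP']
  · simp [cellMap]

/-- The horizontal degrees satisfying `A` are among `p - 1`, `p`, and the vertical degrees satisfying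
`B` are among `q - 1`, `q`. -/
structure IsBox (p : ℕ) (q : ℤ) (A : ℕ → Prop) (B : ℤ → Prop) : Prop where
  left (a : ℕ) : A a → a = p ∨ a + 1 = p
  right (b : ℤ) : B b → b = q ∨ b + 1 = q

/-- The bicomplex with `k` in the bidegrees `(a, b)` such that `A a` and `B b`, where `A` is contained
in `{p - 1, p}` and `B` in `{q - 1, q}`, and with `0` elsewhere. All differentials between
two copies of `k` are identities, except for the vertical differential of the column `p`, which is
`-1`. -/
noncomputable def ofBox {p : ℕ} {q : ℤ} {A : ℕ → Prop} {B : ℤ → Prop} (h : IsBox p q A B) :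
    BCh k where
  col a :=
    { X := fun b => ModuleCat.of k (cell k (A a ∧ B b))
      d := fun b b' => if b' + 1 = b then
        ModuleCat.ofHom (cellMap (A a ∧ B b) (A a ∧ B b') (if a = p then -1 else 1)) else 0
      shape := fun b b' hb => if_neg hb
      d_comp_d' := fun b b' b'' hb hb' => by
        change b' + 1 = b at hb
        change b'' + 1 = b' at hb'
        rw [if_pos hb, if_pos hb', ← ModuleCat.ofHom_comp, cellMap_comp_eq_zero]
        · rfl
        · rintro ⟨⟨_, h1⟩, _, ⟨_, h3⟩⟩
          have := h.right _ h1
          have := h.right _ h3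
          omega }
  dh a b := ModuleCat.ofHom (cellMap (A (a + 1) ∧ B b) (A a ∧ B b) 1)
  dh_comp_dh a b := by
    rw [← ModuleCat.ofHom_comp, cellMap_comp_eq_zero]
    · rfl
    · rintro ⟨⟨h1, _⟩, _, ⟨h3, _⟩⟩
      have := h.left _ h1
      have := h.left _ h3
      omega
  anticomm a b b' := by
    by_cases hb : b' + 1 = b
    swap
    · simp only [if_neg hb, comp_zero, zero_comp, add_zero]
    simp only [if_pos hb]
    rw [← ModuleCat.ofHom_comp, ← ModuleCat.ofHom_comp,
      cellMap_comp (fun h1 h2 => ⟨h2.1, h1.2⟩), cellMap_comp (fun h1 h2 => ⟨h1.1, h2.2⟩)]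
    by_cases hA : A (a + 1) ∧ A a
    · have h1 := h.left _ hA.1
      have h2 := h.left _ hA.2
      have e1 : a + 1 = p := by omega
      have e2 : ¬ a = p := by omega
      rw [if_pos e1, if_neg e2]
      ext ⟨x, hx⟩
      by_cases hQ : A a ∧ B b' <;> simp [cellMap, hQ]
    · rw [cellMap_eq_zero (fun hh => hA ⟨hh.1.1, hh.2.1⟩),
        cellMap_eq_zero (fun hh => hA ⟨hh.1.1, hh.2.1⟩)]
      exact add_zero _

/-- Inclusion of one such bicomplex into another one: it is the identity of `k` wherever the source is
`k`. The assumptions `hA`, `hB` say that the smaller set of bidegrees is closed under the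
differentials. -/
noncomputable def boxIncl {p : ℕ} {q q' : ℤ} {A A' : ℕ → Prop} {B B' : ℤ → Prop}
    (h : IsBox p q A B) (h' : IsBox p q' A' B') (iA : ∀ a, A a → A' a) (iB : ∀ b, B b → B' b)
    (hA : ∀ a, A (a + 1) → A' a → A a) (hB : ∀ b, B (b + 1) → B' b → B b) :
    ofBox (k := k) h ⟶ ofBox (k := k) h' where
  f a :=
    { f := fun b => ModuleCat.ofHom (Submodule.inclusion
        (cell_mono fun hh : A a ∧ B b => ⟨iA a hh.1, iB b hh.2⟩))
      comm' := fun b b' hb => by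
        change b' + 1 = b at hb
        subst hb
        simp only [ofBox, if_true]
        rw [← ModuleCat.ofHom_comp, ← ModuleCat.ofHom_comp,
          cellMap_inclusion (k := k)
            (fun hh : A a ∧ B (b' + 1) => ⟨iA a hh.1, iB (b' + 1) hh.2⟩)
            (fun hh : A a ∧ B b' => ⟨iA a hh.1, iB b' hh.2⟩)]
        exact fun h1 h2 => ⟨h1.1, hB _ h1.2 h2.2⟩ }
  comm a b := by
    simp only [ofBox]
    rw [← ModuleCat.ofHom_comp, ← ModuleCat.ofHom_comp,
      cellMap_inclusion (k := k)
        (fun hh : A (a + 1) ∧ B b => ⟨iA (a + 1) hh.1, iB b hh.2⟩)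
        (fun hh : A a ∧ B b => ⟨iA a hh.1, iB b hh.2⟩)]
    exact fun h1 h2 => ⟨hA _ h1.1 h2.1, h1.2⟩

variable (k)

/-- The sphere `S^{p,q}`: `k` in bidegree `(p, q)`, and `0` elsewhere. -/
noncomputable def sphere (p : ℕ) (q : ℤ) : BCh k :=
  ofBox (p := p + 1) (q := q + 1) (A := fun a => a = p) (B := fun b => b = q)
    ⟨fun _ h => Or.inr (by omega), fun _ h => Or.inr (by omega)⟩

/-- The disc `D^{p,q}` (for `p > 0`): `k` in the four bidegrees `(p, q)`, `(p - 1, q)`, `(p, q - 1)`,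
`(p - 1, q - 1)`, and `0` elsewhere. -/
noncomputable def disc (p : ℕ) (q : ℤ) : BCh k :=
  ofBox (p := p) (q := q) (A := fun a => a = p ∨ a + 1 = p) (B := fun b => b = q ∨ b + 1 = q)
    ⟨fun _ h => h, fun _ h => h⟩

/-- The horizontal boundaries `∂_h D^{p,q}` of the disc (for `p > 0`): `k` in the bidegrees
`(p - 1, q)` and `(p - 1, q - 1)`, and `0` elsewhere. -/
noncomputable def hBdDisc (p : ℕ) (q : ℤ) : BCh k :=
  ofBox (p := p) (q := q) (A := fun a => a + 1 = p) (B := fun b => b = q ∨ b + 1 = q)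
    ⟨fun _ h => Or.inr h, fun _ h => h⟩

/-- The vertical boundaries `∂_v D^{p,q}` of the disc (for `p > 0`): `k` in the bidegrees
`(p, q - 1)` and `(p - 1, q - 1)`, and `0` elsewhere. -/
noncomputable def vBdDisc (p : ℕ) (q : ℤ) : BCh k :=
  ofBox (p := p) (q := q) (A := fun a => a = p ∨ a + 1 = p) (B := fun b => b + 1 = q)
    ⟨fun _ h => h, fun _ h => Or.inr h⟩

/-- The inclusion `∂_v D^{p,q} ↪ D^{p,q}`. -/
noncomputable def vBdDiscIncl (p : ℕ) (q : ℤ) : vBdDisc k p q ⟶ disc k p q :=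
  boxIncl _ _ (fun _ h => h) (fun _ h => Or.inr h) (fun _ _ h => h) (fun _ h h' => by omega)

/-- The inclusion `S^{0,q-1} ↪ ∂_h D^{1,q}`. -/
noncomputable def sphereIncl (q : ℤ) : sphere k 0 (q - 1) ⟶ hBdDisc k 1 q :=
  boxIncl _ _ (fun _ h => by omega) (fun _ h => Or.inr (by omega)) (fun _ _ h => by omega)
    (fun _ h h' => by omega)

/-- The zero bicomplex. -/
noncomputable def zero : BCh k where
  col _ :=
    { X := fun _ => ModuleCat.of k PUnit.{u + 1}
      d := fun _ _ => 0
      shape := fun _ _ _ => rfl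
      d_comp_d' := fun _ _ _ _ _ => comp_zero }
  dh _ _ := 0
  dh_comp_dh _ _ := comp_zero
  anticomm _ _ _ := by simp

/-- The map from the zero bicomplex to a bicomplex. -/
noncomputable def fromZero (X : BCh k) : zero k ⟶ X where
  f _ := { f := fun _ => 0 }
  comm p q := by
    change 0 ≫ 0 = 0 ≫ X.dh p q
    rw [comp_zero, zero_comp]

/-! ### The classes of morphisms of the total model structure -/

/-- The set `I_Tot` consisting of the inclusions `S^{0,q-1} ↪ ∂_h D^{1,q}`, `q : ℤ`, and
`∂_v D^{p,q} ↪ D^{p,q}`, `p > 0`, `q : ℤ`. -/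
def ITot : MorphismProperty (BCh k) :=
  MorphismProperty.ofHoms (fun q : ℤ => sphereIncl k q) ⊔
    MorphismProperty.ofHoms (fun i : {p : ℕ // 0 < p} × ℤ => vBdDiscIncl k i.1.1 i.2)

/-- The set `J_Tot` consisting of the inclusions `0 ↪ ∂_h D^{1,q}`, `q : ℤ`, and
`∂_v D^{p,q} ↪ D^{p,q}`, `p > 0`, `q : ℤ`. -/
def JTot : MorphismProperty (BCh k) :=
  MorphismProperty.ofHoms (fun q : ℤ => fromZero k (hBdDisc k 1 q)) ⊔
    MorphismProperty.ofHoms (fun i : {p : ℕ // 0 < p} × ℤ => vBdDiscIncl k i.1.1 i.2)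

end BCh

/-! ### Properties of model categories -/

namespace HomotopicalAlgebra

universe w v u'

variable (C : Type u') [Category.{v} C]

/-- A model category is left proper if weak equivalences are stable under pushout along
cofibrations, right proper if they are stable under pullback along fibrations, and proper if it
is both. -/
structure IsProperModel [ModelCategory C] : Prop where
  left {A B X Y : C} {i : A ⟶ X} {w : A ⟶ B} {w' : X ⟶ Y} {j : B ⟶ Y} (sq : IsPushout i w w' j)
    (hi : Cofibration i) (hw : WeakEquivalence w) : WeakEquivalence w'
  right {A B X Y : C} {w' : A ⟶ B} {q : A ⟶ X} {p : B ⟶ Y} {w : X ⟶ Y} (sq : IsPullback w' q p w)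
    (hp : Fibration p) (hw : WeakEquivalence w) : WeakEquivalence w'

variable {C} in
/-- A model category is cofibrantly generated, with generating cofibrations `I` and generating
trivial cofibrations `J`, if the sets `I` and `J` permit the small object argument, the fibrations are
the maps with the right lifting property with respect to `J`, and the trivial fibrations are the
maps with the right lifting property with respect to `I`. -/
structure IsCofibrantlyGeneratedBy [ModelCategory C] (I J : MorphismProperty C) : Prop where
  small_I : MorphismProperty.HasSmallObjectArgument.{w} I
  small_J : MorphismProperty.HasSmallObjectArgument.{w} J
  fibrations_eq : fibrations C = J.rlp
  trivialFibrations_eq : trivialFibrations C = I.rlp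

/-- A model category is combinatorial if it is cofibrantly generated and its underlying category is
locally presentable. -/
structure IsCombinatorialModel [ModelCategory C] : Prop where
  locallyPresentable : IsLocallyPresentable.{w} C
  cofibrantlyGenerated : ∃ I J : MorphismProperty C, IsCofibrantlyGeneratedBy.{w} I J

/-- A model structure on an abelian category is abelian if the (trivial) cofibrations are the
monomorphisms with (trivially) cofibrant cokernel, and the (trivial) fibrations are the epimorphisms
with (trivially) fibrant kernel. -/
structure IsAbelianModel [Abelian C] [ModelCategory C] : Prop where
  cofibration_iff {X Y : C} (f : X ⟶ Y) :
    Cofibration f ↔ Mono f ∧ IsCofibrant (cokernel f)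
  trivialCofibration_iff {X Y : C} (f : X ⟶ Y) :
    trivialCofibrations C f ↔
      Mono f ∧ IsCofibrant (cokernel f) ∧ WeakEquivalence (initial.to (cokernel f))
  fibration_iff {X Y : C} (f : X ⟶ Y) :
    Fibration f ↔ Epi f ∧ IsFibrant (kernel f)
  trivialFibration_iff {X Y : C} (f : X ⟶ Y) :
    trivialFibrations C f ↔
      Epi f ∧ IsFibrant (kernel f) ∧ WeakEquivalence (terminal.from (kernel f))

end HomotopicalAlgebra

/-! The small object argument for `ITot` and `JTot` yields two factorizations; the work lies in
recognising the resulting classes. Morphisms out of the generators are elements: discs, and ∂_h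
D^{1,q} in column 0, corepresent the components of a bicomplex, while vertical boundaries and
spheres corepresent vertical cycles. So lifting against `ITot` is the classical sphere-disc lifting
in every column, which means surjective with every column a quasi-isomorphism
(`ChainComplex.hasDiscLifting_iff`). Lifting against `JTot` asks this only in positive columns, plus
surjectivity in column 0.

A fibration has a kernel with exact positive columns. An element of Tot has finitely many nonzero
components, so these columns can be cleared from the right, and Tot of the kernel is acyclic exactly
when column 0 is (`acyclic_tot_iff`). Hence the maps lifting against `ITot` are the fibrations that
are weak equivalences.

Conversely, a map with the left lifting property against fibrations is a weak equivalence
(`quasiIso_of_jtot_llp`): its cokernel Q lifts against the fibration `pathProj`, and a section of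
`pathProj` is a contraction of Tot(Q). The retract argument then identifies the trivial cofibrations
(`jtot_llp_eq`).

Cofibrations are injective, and cofibrant objects projective, by lifting against the trivial
fibrations `cofreeMap` between bicomplexes cogenerated by modules. A monomorphism with cofibrant
cokernel is a cofibration because a suitable pullback can be split
(`llp_of_llp_initial_to_cokernel`). Properness and abelianness follow from exactness of Tot and long
exact sequences.

For the underlying category, the sign (-1)^q on d_h turns a bicomplex into a complex of complexes,
which carries over abelianness, limits and colimits. The corepresenting objects form a strong
generator of finitely presentable objects. -/

namespace BCh

/-! ### Bicomplexes as complexes of complexes. -/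

variable {k : Type u} [CommRing k]

/-- The horizontal differential, with alternating signs, is a chain map between the columns. -/
noncomputable def dhCol (X : BCh k) (p : ℕ) : X.col (p + 1) ⟶ X.col p where
  f q := q.negOnePow • X.dh p q
  comm' q q' h := by
    have h' : q' + 1 = q := h
    subst h'
    rw [Linear.units_smul_comp, Linear.comp_units_smul, Int.negOnePow_succ, Units.neg_smul,
      eq_neg_of_add_eq_zero_left (X.anticomm p (q' + 1) q'), smul_neg, neg_neg]

theorem dhCol_comp (X : BCh k) (p : ℕ) : X.dhCol (p + 1) ≫ X.dhCol p = 0 := by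
  ext1 q
  simp [dhCol, X.dh_comp_dh]

variable (k) in
/-- A bicomplex, seen as a chain complex of chain complexes. -/
noncomputable def toComplex : BCh k ⥤ ChainComplex (ChainComplex (ModuleCat.{u} k) ℤ) ℕ where
  obj X := ChainComplex.of X.col X.dhCol X.dhCol_comp
  map φ := ChainComplex.ofHom (Hom.f φ) (fun p => by
    ext1 q
    simp [dhCol, φ.comm p q])

instance : (toComplex k).Faithful where
  map_injective {X Y φ ψ} h := by
    apply Hom.ext
    funext p
    exact congrArg (fun g => HomologicalComplex.Hom.f g p) h

instance : (toComplex k).Full where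
  map_surjective {X Y} g := by
    refine ⟨⟨fun p => g.f p, fun p q => ?_⟩, ?_⟩
    · have h := congrArg (fun g => HomologicalComplex.Hom.f g q) (g.comm (p + 1) p)
      simpa [toComplex, dhCol] using h.symm
    · ext p : 1
      rfl

/-- Applying the sign (-1)^q a second time undoes it, so the columns are unchanged and the
isomorphism is the identity in each degree. -/
instance : (toComplex k).EssSurj where
  mem_essImage K := by
    let X : BCh k :=
      { col := K.X
        dh p q := q.negOnePow • (K.d (p + 1) p).f q
        dh_comp_dh p q := by
          simp [← HomologicalComplex.comp_f]
        anticomm p q q' := by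
          by_cases h : q' + 1 = q
          · subst h
            simp [Int.negOnePow_succ]
          · simp [(K.X p).shape q q' h, (K.X (p + 1)).shape q q' h] }
    refine ⟨X, ⟨HomologicalComplex.Hom.isoOfComponents (fun p => Iso.refl _) ?_⟩⟩
    intro p p' h
    have h' : p' + 1 = p := h
    subst h'
    ext q : 1
    simp [toComplex, dhCol, X, smul_smul]

instance : (toComplex k).IsEquivalence where

noncomputable scoped instance : Preadditive (BCh k) :=
  Preadditive.ofFullyFaithful (Functor.FullyFaithful.ofFullyFaithful (toComplex k))

scoped instance : (toComplex k).Additive := Functor.FullyFaithful.additive_ofFullyFaithful _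

scoped instance : HasFiniteLimits (BCh k) :=
  ⟨fun _ _ _ => Adjunction.hasLimitsOfShape_of_equivalence (toComplex k)⟩

noncomputable scoped instance : Abelian (BCh k) := abelianOfEquivalence (toComplex k)

scoped instance : HasLimitsOfSize.{u, u} (BCh k) :=
  Adjunction.has_limits_of_equivalence (toComplex k)

scoped instance : HasColimitsOfSize.{u, u} (BCh k) :=
  Adjunction.has_colimits_of_equivalence (toComplex k)

end BCh

/-! ### Quasi-isomorphisms and short exact sequences of complexes. -/

section ShortExactSequences

open HomologicalComplex ComposableArrows Abelian

variable {C : Type*} [Category* C] [Abelian C] {S₁ S₂ : ShortComplex (ChainComplex C ℤ)}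

/-- Given a morphism of short exact sequences of chain complexes, if the outer two morphisms are
quasi-isomorphisms, then so is the middle one. -/
theorem HomologicalComplex.HomologySequence.quasiIso_τ₂ (φ : S₁ ⟶ S₂) (hS₁ : S₁.ShortExact)
    (hS₂ : S₂.ShortExact) (h₁ : QuasiIso φ.τ₁) (h₃ : QuasiIso φ.τ₃) : QuasiIso φ.τ₂ := by
  rw [quasiIso_iff]
  intro i
  rw [quasiIsoAt_iff_isIso_homologyMap]
  -- Four lemma on H_{i+1}(X₃) → H_i(X₁) → H_i(X₂) → H_i(X₃); surjectivity below uses H_i(X₁) →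
  -- H_i(X₂) → H_i(X₃) → H_{i-1}(X₁).
  have hm : Mono (homologyMap φ.τ₂ i) := by
    have hij : (ComplexShape.down ℤ).Rel (i + 1) i := rfl
    apply mono_of_epi_of_mono_of_mono
      ((δ₀Functor ⋙ δ₀Functor).map (mapComposableArrows₅ φ hS₁ hS₂ (i + 1) i hij))
    · exact (composableArrows₅_exact hS₁ _ _ hij).δ₀.δ₀
    · exact (composableArrows₅_exact hS₂ _ _ hij).δ₀.δ₀
    · change Epi (homologyMap φ.τ₃ (i + 1)); infer_instance
    · change Mono (homologyMap φ.τ₁ i); infer_instance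
    · change Mono (homologyMap φ.τ₃ i); infer_instance
  have he : Epi (homologyMap φ.τ₂ i) := by
    have hij : (ComplexShape.down ℤ).Rel i (i - 1) := by simp
    apply epi_of_epi_of_epi_of_mono
      ((δlastFunctor ⋙ δlastFunctor).map (mapComposableArrows₅ φ hS₁ hS₂ i (i - 1) hij))
    · exact (composableArrows₅_exact hS₁ _ _ hij).δlast.δlast
    · exact (composableArrows₅_exact hS₂ _ _ hij).δlast.δlast
    · change Epi (homologyMap φ.τ₁ i); infer_instance
    · change Epi (homologyMap φ.τ₃ i); infer_instance
    · change Mono (homologyMap φ.τ₁ (i - 1)); infer_instance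
  exact isIso_of_mono_of_epi _

variable {S : ShortComplex (ChainComplex C ℤ)}

theorem ChainComplex.quasiIso_f_iff_of_shortExact (hS : S.ShortExact) :
    QuasiIso S.f ↔ S.X₃.Acyclic := by
  refine ⟨hS.acyclic_X₃, fun h => (quasiIso_iff _).2 fun i => ?_⟩
  rw [quasiIsoAt_iff_isIso_homologyMap]
  have h' (j) : IsZero (S.X₃.homology j) := (h j).isZero_homology
  have hm : Mono (homologyMap S.f i) :=
    (hS.homology_exact₁ (i + 1) i rfl).mono_g ((h' _).eq_of_src _ _)
  have he : Epi (homologyMap S.f i) := (hS.homology_exact₂ i).epi_f ((h' _).eq_of_tgt _ _)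
  exact isIso_of_mono_of_epi _

theorem ChainComplex.quasiIso_g_iff_of_shortExact (hS : S.ShortExact) :
    QuasiIso S.g ↔ S.X₁.Acyclic := by
  refine ⟨hS.acyclic_X₁, fun h => (quasiIso_iff _).2 fun i => ?_⟩
  rw [quasiIsoAt_iff_isIso_homologyMap]
  have h' (j) : IsZero (S.X₁.homology j) := (h j).isZero_homology
  have hm : Mono (homologyMap S.g i) := (hS.homology_exact₂ i).mono_g ((h' _).eq_of_src _ _)
  have he : Epi (homologyMap S.g i) :=
    (hS.homology_exact₃ i (i - 1) (by simp)).epi_f ((h' _).eq_of_tgt _ _)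
  exact isIso_of_mono_of_epi _

end ShortExactSequences

theorem HomologicalComplex.exactAt_iff_forall {R : Type u} [Ring R]
    (K : ChainComplex (ModuleCat.{u} R) ℤ) (q : ℤ) :
    K.ExactAt q ↔ ∀ x : K.X q, K.d q (q - 1) x = 0 → ∃ y : K.X (q + 1), K.d (q + 1) q y = x := by
  rw [K.exactAt_iff' (q + 1) q (q - 1) (by simp) (by simp), ShortComplex.moduleCat_exact_iff]
  rfl

/-! ### Exactness of columns, components and Tot. -/

namespace BCh

variable {k : Type u} [CommRing k]

variable (k) in
/-- The functor taking a bicomplex to its `p`-th column. -/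
noncomputable def colFunctor (p : ℕ) : BCh k ⥤ ChainComplex (ModuleCat.{u} k) ℤ :=
  toComplex k ⋙ HomologicalComplex.eval _ _ p
  deriving Functor.Additive, PreservesFiniteLimits, PreservesFiniteColimits

instance (p : ℕ) : PreservesColimitsOfSize.{u, u} (colFunctor k p) where
  preservesColimitsOfShape := by unfold colFunctor; infer_instance

variable (k) in
/-- The functor taking a bicomplex to its component in bidegree `(p, q)`. -/
noncomputable def evalFunctor (p : ℕ) (q : ℤ) : BCh k ⥤ ModuleCat.{u} k :=
  colFunctor k p ⋙ HomologicalComplex.eval _ _ q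
  deriving Functor.Additive, PreservesFiniteLimits, PreservesFiniteColimits

/-- Needed for filtered colimits, to make the objects corepresenting the components finitely
presentable. -/
instance (p : ℕ) (q : ℤ) : PreservesColimitsOfSize.{u, u} (evalFunctor k p q) where
  preservesColimitsOfShape := by unfold evalFunctor; infer_instance

theorem app_zero (X Y : BCh k) (p : ℕ) (q : ℤ) : app (0 : X ⟶ Y) p q = 0 :=
  (evalFunctor k p q).map_zero X Y

theorem mono_iff {X Y : BCh k} (f : X ⟶ Y) :
    Mono f ↔ ∀ p q, Function.Injective (app f p q) := by
  refine ⟨fun _ p q => ?_, fun h => ⟨fun g g' hg => ?_⟩⟩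
  · exact (ModuleCat.mono_iff_injective _).1 (inferInstanceAs (Mono ((evalFunctor k p q).map f)))
  · refine hom_ext _ _ fun p q => ?_
    have := (ModuleCat.mono_iff_injective _).2 (h p q)
    rw [← cancel_mono (app f p q)]
    exact congrArg (fun g => app g p q) hg

theorem epi_iff {X Y : BCh k} (f : X ⟶ Y) :
    Epi f ↔ ∀ p q, Function.Surjective (app f p q) := by
  refine ⟨fun _ p q => ?_, fun h => ⟨fun g g' hg => ?_⟩⟩
  · exact (ModuleCat.epi_iff_surjective _).1 (inferInstanceAs (Epi ((evalFunctor k p q).map f)))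
  · refine hom_ext _ _ fun p q => ?_
    have := (ModuleCat.epi_iff_surjective _).2 (h p q)
    rw [← cancel_epi (app f p q)]
    exact congrArg (fun g => app g p q) hg

instance : (Tot (k := k)).PreservesZeroMorphisms where
  map_zero X Y := by
    ext n : 2
    refine DirectSum.linearMap_ext k fun i => LinearMap.ext fun x => ?_
    refine (totMap_lof 0 n i x).trans ?_
    rw [app_zero]
    exact map_zero _

theorem shortExact_col {S : ShortComplex (BCh k)} (hS : S.ShortExact) (p : ℕ) :
    (S.map (colFunctor k p)).ShortExact :=
  hS.map_of_exact _

theorem shortExact_eval {S : ShortComplex (BCh k)} (hS : S.ShortExact) (p : ℕ) (q : ℤ) :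
    (S.map (evalFunctor k p q)).ShortExact :=
  hS.map_of_exact _

/-- Direct sums of modules are exact, so exactness of Tot in each degree reduces to exactness in
each bidegree. -/
theorem shortExact_tot {S : ShortComplex (BCh k)} (hS : S.ShortExact) :
    (S.map Tot).ShortExact := by
  refine HomologicalComplex.shortExact_of_degreewise_shortExact _ fun n => ?_
  have hS' (i : TotIdx n) := shortExact_eval hS i.1.1 i.1.2
  refine { exact := ?_, mono_f := ?_, epi_g := ?_ }
  · rw [ShortComplex.moduleCat_exact_iff_ker_sub_range]
    change LinearMap.ker (totMap S.g n) ≤ LinearMap.range (totMap S.f n)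
    rw [totMap, totMap, DirectSum.ker_lmap, DirectSum.range_lmap]
    refine Submodule.comap_mono (Submodule.pi_mono fun i _ => ?_)
    exact (ShortComplex.moduleCat_exact_iff_ker_sub_range _).1 (hS' i).exact
  · rw [ModuleCat.mono_iff_injective]
    exact (DirectSum.lmap_injective _).2 fun i => (hS' i).moduleCat_injective_f
  · rw [ModuleCat.epi_iff_surjective]
    exact (DirectSum.lmap_surjective _).2 fun i => (hS' i).moduleCat_surjective_g

end BCh

/-! ### The total complex without its grading. -/

namespace BCh

variable {k : Type u} [CommRing k]

/-- The direct sum of all the components of a bicomplex, i.e. the total complex without its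
grading. -/
abbrev FlatTot (X : BCh k) : Type u := ⨁ i : ℕ × ℤ, (X.col i.1).X i.2

/-- The inclusion of a component in the ungraded total complex. -/
noncomputable abbrev flatOf (X : BCh k) (p : ℕ) (q : ℤ) : (X.col p).X q →ₗ[k] X.FlatTot :=
  DirectSum.lof k (ℕ × ℤ) (fun i => (X.col i.1).X i.2) (p, q)

/-- The horizontal differential on a summand of the ungraded total complex. -/
noncomputable def flatDh (X : BCh k) : ∀ i : ℕ × ℤ, (X.col i.1).X i.2 →ₗ[k] X.FlatTot
  | (0, _) => 0
  | (p + 1, q) => X.flatOf p q ∘ₗ (X.dh p q).hom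

/-- The vertical differential on a summand of the ungraded total complex. -/
noncomputable def flatDv (X : BCh k) (i : ℕ × ℤ) : (X.col i.1).X i.2 →ₗ[k] X.FlatTot :=
  X.flatOf i.1 (i.2 - 1) ∘ₗ ((X.col i.1).d i.2 (i.2 - 1)).hom

/-- The differential of the ungraded total complex. -/
noncomputable def flatD (X : BCh k) : X.FlatTot →ₗ[k] X.FlatTot :=
  DirectSum.toModule k (ℕ × ℤ) X.FlatTot fun i => X.flatDh i + X.flatDv i

/-- Leaving q' free avoids transports between degrees such as q and q + 1 - 1. -/
theorem flatDv_apply (X : BCh k) (p : ℕ) {q q' : ℤ} (h : q' + 1 = q) (x : (X.col p).X q) :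
    X.flatDv (p, q) x = X.flatOf p q' ((X.col p).d q q' x) := by
  obtain rfl : q' = q - 1 := by omega
  rfl

theorem flatD_flatOf (X : BCh k) (p : ℕ) (q : ℤ) (x : (X.col p).X q) :
    X.flatD (X.flatOf p q x) = X.flatDh (p, q) x + X.flatDv (p, q) x :=
  DirectSum.toModule_lof k _ _

theorem flatD_flatOf_zero (X : BCh k) {q q' : ℤ} (h : q' + 1 = q) (x : (X.col 0).X q) :
    X.flatD (X.flatOf 0 q x) = X.flatOf 0 q' ((X.col 0).d q q' x) := by
  rw [flatD_flatOf, flatDv_apply X 0 h]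
  exact zero_add _

theorem flatD_flatOf_succ (X : BCh k) (p : ℕ) {q q' : ℤ} (h : q' + 1 = q)
    (x : (X.col (p + 1)).X q) :
    X.flatD (X.flatOf (p + 1) q x) =
      X.flatOf p q (X.dh p q x) + X.flatOf (p + 1) q' ((X.col (p + 1)).d q q' x) := by
  rw [flatD_flatOf, flatDv_apply X _ h]
  rfl

theorem flatOf_apply_self (X : BCh k) (p : ℕ) (q : ℤ) (x : (X.col p).X q) :
    X.flatOf p q x (p, q) = x :=
  DirectSum.lof_apply (M := fun i : ℕ × ℤ => (X.col i.1).X i.2) k (p, q) x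

theorem flatOf_apply_of_ne (X : BCh k) {p : ℕ} {q : ℤ} (x : (X.col p).X q) {i : ℕ × ℤ}
    (h : (p, q) ≠ i) : X.flatOf p q x i = 0 :=
  DirectSum.of_eq_of_ne _ _ _ h.symm

/-- Only two components of w contribute to a given bidegree: the one to the right and the one above.
This turns vanishing statements about the differential into checks in a single bidegree. -/
theorem flatD_apply (X : BCh k) (w : X.FlatTot) (p : ℕ) (q : ℤ) :
    X.flatD w (p, q) = X.dh p q (w (p + 1, q)) + (X.col p).d (q + 1) q (w (p, q + 1)) := by
  let c (i : ℕ × ℤ) : X.FlatTot →ₗ[k] (X.col i.1).X i.2 := DirectSum.component k _ _ i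
  change (c (p, q) ∘ₗ X.flatD) w =
    ((X.dh p q).hom ∘ₗ c (p + 1, q) + ((X.col p).d (q + 1) q).hom ∘ₗ c (p, q + 1)) w
  congr 1
  refine DirectSum.linearMap_ext k fun ⟨a, b⟩ => LinearMap.ext fun x => ?_
  change X.flatD (X.flatOf a b x) (p, q) =
    X.dh p q (X.flatOf a b x (p + 1, q)) + (X.col p).d (q + 1) q (X.flatOf a b x (p, q + 1))
  have hv : X.flatDv (a, b) x (p, q) = (X.col p).d (q + 1) q (X.flatOf a b x (p, q + 1)) := by
    by_cases h : (a, b) = (p, q + 1)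
    · obtain ⟨rfl, rfl⟩ := Prod.mk.inj h
      rw [flatDv_apply X a rfl, flatOf_apply_self, flatOf_apply_self]
    · rw [flatDv_apply X a (sub_add_cancel b 1), flatOf_apply_of_ne, flatOf_apply_of_ne _ _ h,
        map_zero]
      rintro h'
      obtain ⟨rfl, rfl⟩ := Prod.mk.inj h'
      simp at h
  have hh : X.flatDh (a, b) x (p, q) = X.dh p q (X.flatOf a b x (p + 1, q)) := by
    by_cases h : (a, b) = (p + 1, q)
    · obtain ⟨rfl, rfl⟩ := Prod.mk.inj h
      rw [flatOf_apply_self]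
      exact flatOf_apply_self X p b _
    · rw [flatOf_apply_of_ne _ _ h, map_zero]
      cases a with
      | zero => rfl
      | succ a =>
        refine flatOf_apply_of_ne X _ fun h' => h ?_
        obtain ⟨rfl, rfl⟩ := Prod.mk.inj h'
        rfl
  rw [flatD_flatOf, DirectSum.add_apply, hv, hh]

theorem flatD_flatD (X : BCh k) (w : X.FlatTot) : X.flatD (X.flatD w) = 0 := by
  refine DFinsupp.ext fun ⟨p, q⟩ => ?_
  have h1 (y : (X.col (p + 1 + 1)).X q) : (X.dh p q) ((X.dh (p + 1) q) y) = 0 :=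
    congrArg (fun g => g.hom y) (X.dh_comp_dh p q)
  have h2 (y : (X.col p).X (q + 1 + 1)) : (X.col p).d (q + 1) q
      ((X.col p).d (q + 1 + 1) (q + 1) y) = 0 :=
    congrArg (fun g => g.hom y) ((X.col p).d_comp_d (q + 1 + 1) (q + 1) q)
  have h3 (y : (X.col (p + 1)).X (q + 1)) : (X.col p).d (q + 1) q (X.dh p (q + 1) y) +
      X.dh p q ((X.col (p + 1)).d (q + 1) q y) = 0 :=
    congrArg (fun g => g.hom y) (X.anticomm p (q + 1) q)
  change X.flatD (X.flatD w) (p, q) = 0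
  rw [flatD_apply, flatD_apply, flatD_apply, map_add, map_add, h1, h2, zero_add, add_zero,
    add_comm, h3]

/-! ### Comparison with the total complex -/

/-- The inclusion of `Tot_n(X)` in the ungraded total complex. -/
noncomputable def toFlat (X : BCh k) (n : ℤ) : X.TotX n →ₗ[k] X.FlatTot :=
  DirectSum.toModule k (TotIdx n) X.FlatTot fun i => X.flatOf i.1.1 i.1.2

/-- The projection of the ungraded total complex to `Tot_n(X)`. -/
noncomputable def ofFlat (X : BCh k) (n : ℤ) : X.FlatTot →ₗ[k] X.TotX n :=
  DirectSum.toModule k (ℕ × ℤ) (X.TotX n) fun i =>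
    if h : (i.1 : ℤ) + i.2 = n then
      DirectSum.lof k (TotIdx n) (fun i => (X.col i.1.1).X i.1.2) ⟨i, h⟩ else 0

theorem toFlat_lof (X : BCh k) (n : ℤ) (i : TotIdx n) (x : (X.col i.1.1).X i.1.2) :
    X.toFlat n (DirectSum.lof k (TotIdx n) (fun i => (X.col i.1.1).X i.1.2) i x) =
      X.flatOf i.1.1 i.1.2 x :=
  DirectSum.toModule_lof k _ _

theorem ofFlat_flatOf (X : BCh k) {n : ℤ} {p : ℕ} {q : ℤ} (h : (p : ℤ) + q = n)
    (x : (X.col p).X q) :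
    X.ofFlat n (X.flatOf p q x) =
      DirectSum.lof k (TotIdx n) (fun i => (X.col i.1.1).X i.1.2) ⟨(p, q), h⟩ x := by
  refine (DirectSum.toModule_lof k _ _).trans ?_
  rw [dif_pos h]

theorem ofFlat_flatOf_of_ne (X : BCh k) {n : ℤ} {p : ℕ} {q : ℤ} (h : (p : ℤ) + q ≠ n)
    (x : (X.col p).X q) : X.ofFlat n (X.flatOf p q x) = 0 := by
  refine (DirectSum.toModule_lof k _ _).trans ?_
  rw [dif_neg h]
  rfl

theorem ofFlat_toFlat (X : BCh k) (n : ℤ) (z : X.TotX n) : X.ofFlat n (X.toFlat n z) = z := by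
  change (X.ofFlat n ∘ₗ X.toFlat n) z = (LinearMap.id : X.TotX n →ₗ[k] X.TotX n) z
  congr 1
  refine DirectSum.linearMap_ext k fun i => LinearMap.ext fun x => ?_
  change X.ofFlat n (X.toFlat n
    (DirectSum.lof k (TotIdx n) (fun i => (X.col i.1.1).X i.1.2) i x)) = _
  rw [toFlat_lof, ofFlat_flatOf X i.2]
  rfl

theorem toFlat_apply_of_ne (X : BCh k) {n : ℤ} (z : X.TotX n) {p : ℕ} {q : ℤ}
    (h : (p : ℤ) + q ≠ n) : X.toFlat n z (p, q) = 0 := by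
  change (DirectSum.component k (ℕ × ℤ) (fun i => (X.col i.1).X i.2) (p, q) ∘ₗ X.toFlat n) z =
    (0 : _ →ₗ[k] (X.col p).X q) z
  congr 1
  refine DirectSum.linearMap_ext k fun i => LinearMap.ext fun x => ?_
  change X.toFlat n (DirectSum.lof k (TotIdx n) (fun i => (X.col i.1.1).X i.1.2) i x) (p, q) = 0
  rw [toFlat_lof]
  refine flatOf_apply_of_ne X x ?_
  rintro h'
  have := i.2
  rw [show i.1 = (p, q) from h'] at this
  exact h this

theorem toFlat_totD (X : BCh k) {n n' : ℤ} (h : n' + 1 = n) (z : X.TotX n) :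
    X.toFlat n' (X.totD n n' z) = X.flatD (X.toFlat n z) := by
  change (X.toFlat n' ∘ₗ X.totD n n') z = (X.flatD ∘ₗ X.toFlat n) z
  congr 1
  refine DirectSum.linearMap_ext k fun i => LinearMap.ext fun x => ?_
  change X.toFlat n' (X.totD n n'
    (DirectSum.lof k (TotIdx n) (fun i => (X.col i.1.1).X i.1.2) i x)) =
    X.flatD (X.toFlat n (DirectSum.lof k (TotIdx n) (fun i => (X.col i.1.1).X i.1.2) i x))
  rw [totD_lof X n n' h, toFlat_lof, map_add, flatD_flatOf]
  congr 1
  · obtain ⟨⟨_ | p, q⟩, hi⟩ := i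
    · exact map_zero _
    · exact toFlat_lof X n' _ _
  · exact toFlat_lof X n' _ _

theorem ofFlat_flatD (X : BCh k) {n n' : ℤ} (h : n' + 1 = n) (z : X.FlatTot) :
    X.ofFlat n' (X.flatD z) = X.totD n n' (X.ofFlat n z) := by
  change (X.ofFlat n' ∘ₗ X.flatD) z = (X.totD n n' ∘ₗ X.ofFlat n) z
  congr 1
  refine DirectSum.linearMap_ext k fun ⟨p, q⟩ => LinearMap.ext fun x => ?_
  change X.ofFlat n' (X.flatD (X.flatOf p q x)) = X.totD n n' (X.ofFlat n (X.flatOf p q x))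
  rw [flatD_flatOf, map_add]
  by_cases hpq : (p : ℤ) + q = n
  · rw [ofFlat_flatOf X hpq, totD_lof X n n' h]
    congr 1
    · cases p with
      | zero => exact map_zero _
      | succ p => exact ofFlat_flatOf X _ _
    · exact ofFlat_flatOf X _ _
  · rw [ofFlat_flatOf_of_ne X hpq, map_zero, flatDv, LinearMap.comp_apply,
      ofFlat_flatOf_of_ne X (by dsimp only; omega), add_zero]
    cases p with
    | zero => exact map_zero _
    | succ p => exact ofFlat_flatOf_of_ne X (by push_cast at hpq; omega) _

theorem exactAt_tot_iff (X : BCh k) (n : ℤ) :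
    (Tot.obj X).ExactAt n ↔
      ∀ z : X.TotX n, X.totD n (n - 1) z = 0 → ∃ w : X.TotX (n + 1), X.totD (n + 1) n w = z :=
  HomologicalComplex.exactAt_iff_forall _ n

/-- The primitive w need not be homogeneous: `ofFlat` commutes with the differentials, so the part
of w in degree n + 1 is already a primitive of the homogeneous z. -/
theorem exactAt_tot_of_flat (X : BCh k) (n : ℤ)
    (h : ∀ z : X.FlatTot, (∀ (p : ℕ) (q : ℤ), (p : ℤ) + q ≠ n → z (p, q) = 0) → X.flatD z = 0 →
      ∃ w, X.flatD w = z) : (Tot.obj X).ExactAt n := by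
  rw [exactAt_tot_iff]
  intro z hz
  obtain ⟨w, hw⟩ := h (X.toFlat n z) (fun p q hpq => X.toFlat_apply_of_ne z hpq)
    (by rw [← X.toFlat_totD (sub_add_cancel n 1), hz, map_zero])
  exact ⟨X.ofFlat (n + 1) w, by rw [← X.ofFlat_flatD rfl, hw, ofFlat_toFlat]⟩

/-! ### Bicomplexes whose columns in positive degrees are exact -/

/-- If the columns of positive degree are exact, then any homogeneous element of the total complex
whose differential is concentrated in the column `0` is homologous to one which is itself
concentrated in the column `0`. -/
theorem exists_sub_flatD_of_acyclic (X : BCh k) (hX : ∀ p, 0 < p → (X.col p).Acyclic)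
    (n : ℤ) (w : X.FlatTot) (hn : ∀ (p : ℕ) (q : ℤ), (p : ℤ) + q ≠ n → w (p, q) = 0)
    (hw : ∀ p, 0 < p → ∀ q, X.flatD w (p, q) = 0) :
    ∃ u : X.FlatTot, (∀ (p : ℕ) (q : ℤ), (p : ℤ) + q ≠ n → (w - X.flatD u) (p, q) = 0) ∧
      ∀ p, 0 < p → ∀ q, (w - X.flatD u) (p, q) = 0 := by
  classical
  -- A direct sum has finite support, so w has a last nonzero column. The induction removes it.
  obtain ⟨N, hN⟩ : ∃ N : ℕ, ∀ p, N < p → ∀ q, w (p, q) = 0 := by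
    refine ⟨(DFinsupp.support w).sup Prod.fst, fun p hp q => ?_⟩
    by_contra h
    exact absurd (Finset.le_sup (f := Prod.fst) (DFinsupp.mem_support_iff.2 h)) (not_le.2 hp)
  induction N generalizing w with
  | zero => exact ⟨0, by simpa using hn, by simpa using hN⟩
  | succ N ih =>
    obtain ⟨q, hq⟩ : ∃ q : ℤ, ((N + 1 : ℕ) : ℤ) + q = n := ⟨n - (N + 1 : ℕ), by ring⟩
    -- Column N + 2 of w vanishes, so the differential of w in column N + 1 is purely vertical: the
    -- last component of w is a vertical cycle.
    have hc : (X.col (N + 1)).d q (q - 1) (w (N + 1, q)) = 0 := by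
      have := hw (N + 1) N.succ_pos (q - 1)
      rw [flatD_apply, hN (N + 1 + 1) (by omega), map_zero, zero_add] at this
      rwa [sub_add_cancel] at this
    obtain ⟨v, hv⟩ := (HomologicalComplex.exactAt_iff_forall _ q).1
      (hX (N + 1) N.succ_pos q) _ hc
    -- Subtracting the total differential of v cancels the last component and changes w otherwise
    -- only in column N.
    have hD := X.flatD_flatOf_succ N (rfl : q + 1 = q + 1) v
    rw [hv] at hD
    have hpq (p' : ℕ) (q' : ℤ) (h : (p' : ℤ) + q' ≠ n) :
        X.flatD (X.flatOf (N + 1) (q + 1) v) (p', q') = 0 := by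
      rw [hD, DirectSum.add_apply, flatOf_apply_of_ne, flatOf_apply_of_ne, add_zero]
      · rintro h'
        obtain ⟨rfl, rfl⟩ := Prod.mk.inj h'
        omega
      · rintro h'
        obtain ⟨rfl, rfl⟩ := Prod.mk.inj h'
        push_cast at hq
        omega
    have hn' (p' : ℕ) (q' : ℤ) (h : (p' : ℤ) + q' ≠ n) :
        (w - X.flatD (X.flatOf (N + 1) (q + 1) v)) (p', q') = 0 := by
      rw [DirectSum.sub_apply, hn _ _ h, hpq _ _ h, sub_zero]
    have hw' (p' : ℕ) (h : 0 < p') (q' : ℤ) :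
        X.flatD (w - X.flatD (X.flatOf (N + 1) (q + 1) v)) (p', q') = 0 := by
      rw [map_sub, flatD_flatD, sub_zero, hw p' h]
    have hN' (p' : ℕ) (h : N < p') (q' : ℤ) :
        (w - X.flatD (X.flatOf (N + 1) (q + 1) v)) (p', q') = 0 := by
      by_cases h1 : (p', q') = (N + 1, q)
      · obtain ⟨rfl, rfl⟩ := Prod.mk.inj h1
        rw [DirectSum.sub_apply, hD, DirectSum.add_apply, flatOf_apply_self, flatOf_apply_of_ne,
          zero_add, sub_self]
        simp
      · have h2 : w (p', q') = 0 := by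
          by_cases h3 : p' = N + 1
          · exact hn _ _ fun h4 => h1 (by subst h3; simp; omega)
          · exact hN p' (by omega) q'
        rw [DirectSum.sub_apply, h2, zero_sub, neg_eq_zero]
        by_cases h3 : (p' : ℤ) + q' = n
        · rw [hD, DirectSum.add_apply, flatOf_apply_of_ne, flatOf_apply_of_ne _ _ (Ne.symm h1),
            add_zero]
          rintro h'
          obtain ⟨rfl, rfl⟩ := Prod.mk.inj h'
          omega
        · exact hpq _ _ h3
    obtain ⟨u, hu1, hu2⟩ := ih _ hn' hw' hN'
    exact ⟨X.flatOf (N + 1) (q + 1) v + u, by rwa [map_add, ← sub_sub],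
      by rwa [map_add, ← sub_sub]⟩

/-- Column 0 is a subcomplex of Tot. By `exists_sub_flatD_of_acyclic`, both cycles of Tot and
primitives in Tot of cycles of column 0 can be moved into column 0 by subtracting boundaries. -/
theorem acyclic_tot_iff (X : BCh k) (hX : ∀ p, 0 < p → (X.col p).Acyclic) :
    (Tot.obj X).Acyclic ↔ (X.col 0).Acyclic := by
  constructor
  · intro h q
    rw [HomologicalComplex.exactAt_iff_forall]
    intro z hz
    let z' : X.TotX q := DirectSum.lof k (TotIdx q) (fun i => (X.col i.1.1).X i.1.2)
      ⟨(0, q), by simp⟩ z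
    have hz' : X.toFlat q z' = X.flatOf 0 q z := toFlat_lof X q _ _
    obtain ⟨w, hw⟩ := (exactAt_tot_iff X q).1 (h q) z' (by
      rw [← ofFlat_toFlat X q z', ← ofFlat_flatD X (sub_add_cancel q 1), hz',
        flatD_flatOf_zero X (sub_add_cancel q 1), hz, map_zero, map_zero])
    have hw' : X.flatD (X.toFlat (q + 1) w) = X.flatOf 0 q z := by
      rw [← toFlat_totD X rfl, hw, hz']
    -- The primitive w of a column 0 cycle is itself moved into column 0; subtracting a boundary
    -- does not change its differential.
    obtain ⟨u, -, hu⟩ := exists_sub_flatD_of_acyclic X hX (q + 1) (X.toFlat (q + 1) w)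
      (fun p q hpq => X.toFlat_apply_of_ne w hpq) (by
        intro p hp q'
        rw [hw', flatOf_apply_of_ne]
        rintro h'
        have := (Prod.mk.inj h').1
        omega)
    refine ⟨(X.toFlat (q + 1) w - X.flatD u) (0, q + 1), ?_⟩
    have := X.flatD_apply (X.toFlat (q + 1) w - X.flatD u) 0 q
    rw [hu _ Nat.one_pos, map_zero, zero_add, map_sub, flatD_flatD, sub_zero, hw',
      flatOf_apply_self] at this
    exact this.symm
  · intro h n
    refine exactAt_tot_of_flat X n fun z hn hz => ?_
    obtain ⟨u, hu1, hu2⟩ := exists_sub_flatD_of_acyclic X hX n z hn (by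
      intro p _ q
      rw [hz]
      rfl)
    have hy : X.flatOf 0 n ((z - X.flatD u) (0, n)) = z - X.flatD u := by
      refine DFinsupp.ext fun ⟨p, q⟩ => ?_
      by_cases hpq : (0, n) = (p, q)
      · obtain ⟨rfl, rfl⟩ := Prod.mk.inj hpq
        exact flatOf_apply_self X _ _ _
      · refine (flatOf_apply_of_ne X _ hpq).trans ?_
        by_cases hp : p = 0
        · exact (hu1 _ _ fun h' => hpq (by subst hp; simp at h'; simp [h'])).symm
        · exact (hu2 _ (by omega) _).symm
    obtain ⟨v, hv⟩ := (HomologicalComplex.exactAt_iff_forall _ n).1 (h n)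
      ((z - X.flatD u) (0, n)) (by
        have := X.flatD_apply (z - X.flatD u) 0 (n - 1)
        rw [hu2 _ Nat.one_pos, map_zero, zero_add, map_sub, flatD_flatD, sub_zero, hz,
          sub_add_cancel] at this
        exact this.symm)
    refine ⟨u + X.flatOf 0 (n + 1) v, ?_⟩
    rw [map_add, flatD_flatOf_zero X rfl, hv, hy, add_sub_cancel]

end BCh

/-! ### Lifting against inclusions of spheres into discs. -/

namespace ChainComplex

variable {R : Type u} [Ring R] {K L : ChainComplex (ModuleCat.{u} R) ℤ}

theorem f_d_apply (f : K ⟶ L) (q q' : ℤ) (x : K.X q) :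
    L.d q q' (f.f q x) = f.f q' (K.d q q' x) :=
  congrArg (fun g => g.hom x) (f.comm q q')

theorem d_d_apply (K : ChainComplex (ModuleCat.{u} R) ℤ) (q q' q'' : ℤ) (x : K.X q) :
    K.d q' q'' (K.d q q' x) = 0 :=
  congrArg (fun g => g.hom x) (K.d_comp_d q q' q'')

theorem d_apply_eq_zero {q q' : ℤ} {x : K.X q} (h : q' + 1 = q) (hx : K.d q q' x = 0)
    (q'' : ℤ) : K.d q q'' x = 0 := by
  by_cases h' : q'' + 1 = q
  · obtain rfl : q'' = q' := by omega
    exact hx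
  · rw [K.shape q q'' h']
    rfl

/-- The right lifting property with respect to the inclusions of spheres into discs, in terms of
elements. -/
def HasDiscLifting (f : K ⟶ L) : Prop :=
  ∀ (q : ℤ) (x : K.X q) (y : L.X (q + 1)), (∀ q', K.d q q' x = 0) → L.d (q + 1) q y = f.f q x →
    ∃ x' : K.X (q + 1), K.d (q + 1) q x' = x ∧ f.f (q + 1) x' = y

/-- Lift twice: lifting over d y with prescribed boundary 0 gives a cycle x over d y, and then y
lifts to an element with boundary x. -/
theorem HasDiscLifting.surjective {f : K ⟶ L} (hf : HasDiscLifting f) (q : ℤ) :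
    Function.Surjective (f.f q) := by
  intro y
  obtain ⟨q, rfl⟩ : ∃ r, q = r + 1 := ⟨q - 1, by ring⟩
  obtain ⟨x, hx, hxy⟩ : ∃ x : K.X q, (∀ q', K.d q q' x = 0) ∧ f.f q x = L.d (q + 1) q y := by
    obtain ⟨q, rfl⟩ : ∃ r, q = r + 1 := ⟨q - 1, by ring⟩
    obtain ⟨x, hx, hxy⟩ := hf q 0 (L.d (q + 1 + 1) (q + 1) y) (fun _ => map_zero _)
      (by rw [d_d_apply, map_zero])
    exact ⟨x, d_apply_eq_zero rfl hx, hxy⟩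
  obtain ⟨x', -, h⟩ := hf q x y hx hxy.symm
  exact ⟨x', h⟩

/-- For surjective f both conditions say that the kernel is acyclic. The lifting problem with y = 0
asks for a primitive inside the kernel; a general one is solved by any preimage x₀ of y, corrected
by a primitive of the kernel cycle x - d x₀. -/
theorem hasDiscLifting_iff (f : K ⟶ L) :
    HasDiscLifting f ↔ (∀ q, Function.Surjective (f.f q)) ∧ QuasiIso f := by
  have key (hs : ∀ q, Function.Surjective (f.f q)) : HasDiscLifting f ↔ QuasiIso f := by
    have (q : ℤ) : Epi (f.f q) := (ModuleCat.epi_iff_surjective _).2 (hs q)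
    have : Epi f := HomologicalComplex.epi_of_epi_f f inferInstance
    let S := ShortComplex.mk _ _ (kernel.condition f)
    have hS : S.ShortExact := { exact := ShortComplex.exact_kernel f }
    have hSq (q : ℤ) : (S.map (HomologicalComplex.eval _ _ q)).ShortExact := hS.map_of_exact _
    have hi (q : ℤ) : Function.Injective ((kernel.ι f).f q) := (hSq q).moduleCat_injective_f
    have he (q : ℤ) (x : K.X q) (hx : f.f q x = 0) : ∃ y, (kernel.ι f).f q y = x :=
      (ShortComplex.moduleCat_exact_iff _).1 (hSq q).exact x hx
    have h0 (q : ℤ) (z : (kernel f).X q) : f.f q ((kernel.ι f).f q z) = 0 :=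
      congrArg (fun g : kernel f ⟶ L => (g.f q).hom z) (kernel.condition f)
    refine Iff.trans ?_ (quasiIso_g_iff_of_shortExact hS).symm
    constructor
    · intro hf q
      rw [HomologicalComplex.exactAt_iff_forall]
      intro z hz
      obtain ⟨x, hx, hx'⟩ := hf q ((kernel.ι f).f q z) 0 (by
          intro q'
          rw [f_d_apply, d_apply_eq_zero (sub_add_cancel q 1) hz, map_zero])
        (by rw [map_zero, h0])
      obtain ⟨w, rfl⟩ := he _ x hx'
      exact ⟨w, hi q (by rw [← f_d_apply, hx])⟩
    · intro hK q x y hx hxy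
      obtain ⟨x₀, rfl⟩ := hs (q + 1) y
      obtain ⟨z, hz⟩ := he q (x - K.d (q + 1) q x₀) (by
        rw [map_sub, ← hxy, f_d_apply, sub_self])
      obtain ⟨w, hw⟩ := (HomologicalComplex.exactAt_iff_forall _ q).1 (hK q) z (by
        apply hi
        rw [← f_d_apply, hz, map_sub, hx, d_d_apply, sub_zero, map_zero])
      refine ⟨x₀ + (kernel.ι f).f (q + 1) w, ?_, ?_⟩
      · have h1 : K.d (q + 1) q ((kernel.ι f).f (q + 1) w) = x - K.d (q + 1) q x₀ := by
          rw [f_d_apply]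
          exact (congrArg _ hw).trans hz
        rw [map_add, h1, add_sub_cancel]
      · rw [map_add, h0, add_zero]
  exact ⟨fun h => ⟨h.surjective, (key h.surjective).1 h⟩, fun h => (key h.1).2 h.2⟩

end ChainComplex

/-! ### Constructors and elementwise identities. -/

namespace BCh

variable {k : Type u} [CommRing k]

/-- Constructor for bicomplexes from modules, linear maps and identities between elements. -/
noncomputable def ofModules (M : ℕ → ℤ → Type u) [∀ p q, AddCommGroup (M p q)]
    [∀ p q, Module k (M p q)]
    (dv : ∀ p q q', M p q →ₗ[k] M p q') (dh : ∀ p q, M (p + 1) q →ₗ[k] M p q)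
    (hvv : ∀ p q q' q'' x, q'' + 1 = q' → q' + 1 = q → dv p q' q'' (dv p q q' x) = 0)
    (hhh : ∀ p q x, dh p q (dh (p + 1) q x) = 0)
    (hvh : ∀ p q q' x, q' + 1 = q → dv p q q' (dh p q x) + dh p q' (dv (p + 1) q q' x) = 0) :
    BCh k where
  col p :=
    { X q := ModuleCat.of k (M p q)
      d q q' := if q' + 1 = q then ModuleCat.ofHom (dv p q q') else 0
      shape q q' h := if_neg h
      d_comp_d' q q' q'' h h' := by
        change q' + 1 = q at h
        change q'' + 1 = q' at h'
        rw [if_pos h, if_pos h']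
        ext x
        exact hvv p q q' q'' x h' h }
  dh p q := ModuleCat.ofHom (dh p q)
  dh_comp_dh p q := by
    ext x
    exact hhh p q x
  anticomm p q q' := by
    by_cases h : q' + 1 = q
    · dsimp only
      rw [if_pos h, if_pos h]
      ext x
      exact hvh p q q' x h
    · simp [h]

/-- Constructor for morphisms of bicomplexes from linear maps and identities between elements. -/
def homMk {X Y : BCh k} (f : ∀ p q, (X.col p).X q →ₗ[k] (Y.col p).X q)
    (hv : ∀ p q q' x, q' + 1 = q → (Y.col p).d q q' (f p q x) = f p q' ((X.col p).d q q' x))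
    (hh : ∀ p q x, Y.dh p q (f (p + 1) q x) = f p q (X.dh p q x)) : X ⟶ Y where
  f p :=
    { f q := ModuleCat.ofHom (f p q)
      comm' q q' h := by
        ext x
        exact hv p q q' x h }
  comm p q := by
    ext x
    exact (hh p q x).symm

theorem app_dv_apply {X Y : BCh k} (f : X ⟶ Y) (p : ℕ) (q q' : ℤ) (x : (X.col p).X q) :
    (Y.col p).d q q' (app f p q x) = app f p q' ((X.col p).d q q' x) :=
  ChainComplex.f_d_apply _ _ _ _

theorem app_dh_apply {X Y : BCh k} (f : X ⟶ Y) (p : ℕ) (q : ℤ) (x : (X.col (p + 1)).X q) :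
    Y.dh p q (app f (p + 1) q x) = app f p q (X.dh p q x) :=
  (congrArg (fun g => g.hom x) (f.comm p q)).symm

theorem dh_dh_apply (X : BCh k) (p : ℕ) (q : ℤ) (x : (X.col (p + 1 + 1)).X q) :
    X.dh p q (X.dh (p + 1) q x) = 0 :=
  congrArg (fun g => g.hom x) (X.dh_comp_dh p q)

theorem dv_dh_apply (X : BCh k) (p : ℕ) (q q' : ℤ) (x : (X.col (p + 1)).X q) :
    (X.col p).d q q' (X.dh p q x) = - X.dh p q' ((X.col (p + 1)).d q q' x) :=
  eq_neg_of_add_eq_zero_left (congrArg (fun g => g.hom x) (X.anticomm p q q'))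

/-! ### A path object -/

/-- The module in bidegree `(p, q)` of the path object of a bicomplex. An element `(x, s, t)` is to
be thought of as an element `x` together with the values `s = h(x)` and `t = h(d_v x)` of a
contracting homotopy `h` of the total complex. -/
def pathModule (X : BCh k) (p : ℕ) (q : ℤ) :
    Submodule k ((X.col p).X q × X.FlatTot × X.FlatTot) where
  -- In column 0 the total differential is d_v, so the contraction identity d h(x) + h(d x) = x
  -- already forces t = x - d s. In other columns it instead determines h(d_h x).
  carrier := {y | p = 0 → y.2.2 = X.flatOf p q y.1 - X.flatD y.2.1}
  add_mem' {y z} hy hz hp := by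
    change y.2.2 + z.2.2 = X.flatOf p q (y.1 + z.1) - X.flatD (y.2.1 + z.2.1)
    rw [hy hp, hz hp, map_add, map_add]
    abel
  zero_mem' _ := by simp
  smul_mem' c y hy hp := by
    change c • y.2.2 = X.flatOf p q (c • y.1) - X.flatD (c • y.2.1)
    rw [hy hp, map_smul, map_smul, smul_sub]

/-- The vertical differential of the path object. -/
noncomputable def pathDv (X : BCh k) (p : ℕ) (q q' : ℤ) (h : q' + 1 = q) :
    X.pathModule p q →ₗ[k] X.pathModule p q' where
  -- The values of h on d_v x and on d_v d_v x = 0.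
  toFun y := ⟨((X.col p).d q q' y.1.1, y.1.2.2, 0), by
    rintro rfl
    change 0 = X.flatOf 0 q' ((X.col 0).d q q' y.1.1) - X.flatD y.1.2.2
    rw [y.2 rfl, map_sub, flatD_flatD, flatD_flatOf_zero X h]
    abel⟩
  map_add' y z := by
    ext1
    simp
  map_smul' c y := by
    ext1
    simp

/-- The horizontal differential of the path object. -/
noncomputable def pathDh (X : BCh k) (p : ℕ) (q : ℤ) :
    X.pathModule (p + 1) q →ₗ[k] X.pathModule p q where
  -- The contraction identity for x gives h(d_h x) = x - d s - t. Applied to d_v x, with d_v d_h =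
  -- -d_h d_v, it gives h(d_v d_h x) = d t - d_v x.
  toFun y := ⟨(X.dh p q y.1.1, X.flatOf (p + 1) q y.1.1 - X.flatD y.1.2.1 - y.1.2.2,
      X.flatD y.1.2.2 - X.flatOf (p + 1) (q - 1) ((X.col (p + 1)).d q (q - 1) y.1.1)), by
    intro _
    change X.flatD y.1.2.2 - _ = X.flatOf p q (X.dh p q y.1.1) -
      X.flatD (X.flatOf (p + 1) q y.1.1 - X.flatD y.1.2.1 - y.1.2.2)
    rw [map_sub, map_sub, flatD_flatD, flatD_flatOf_succ X p (sub_add_cancel q 1)]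
    abel⟩
  map_add' y z := by
    ext1
    simp only [Submodule.coe_add, Prod.fst_add, Prod.snd_add, map_add]
    refine Prod.ext rfl (Prod.ext ?_ ?_) <;> dsimp only [Prod.fst_add, Prod.snd_add] <;> abel
  map_smul' c y := by
    ext1
    simp [smul_sub]

/-- The path object of a bicomplex: a section of its projection to `X` is the same thing as
a contraction of the total complex of `X`. -/
noncomputable def path (X : BCh k) : BCh k :=
  ofModules (fun p q => X.pathModule p q)
    (fun p q q' => if h : q' + 1 = q then X.pathDv p q q' h else 0) X.pathDh
    (by
      intro p q q' q'' x h h'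
      rw [dif_pos h, dif_pos h']
      ext1
      refine Prod.ext (ChainComplex.d_d_apply _ _ _ _ _) (Prod.ext rfl rfl))
    (by
      intro p q x
      ext1
      refine Prod.ext (X.dh_dh_apply _ _ _) (Prod.ext ?_ ?_)
      · change X.flatOf (p + 1) q (X.dh (p + 1) q x.1.1) -
          X.flatD (X.flatOf (p + 1 + 1) q x.1.1 - X.flatD x.1.2.1 - x.1.2.2) -
          (X.flatD x.1.2.2 - X.flatOf (p + 1 + 1) (q - 1) ((X.col (p + 1 + 1)).d q (q - 1) x.1.1)) =
          0
        rw [map_sub, map_sub, flatD_flatD, flatD_flatOf_succ X _ (sub_add_cancel q 1)]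
        abel
      · change X.flatD (X.flatD x.1.2.2 -
          X.flatOf (p + 1 + 1) (q - 1) ((X.col (p + 1 + 1)).d q (q - 1) x.1.1)) -
          X.flatOf (p + 1) (q - 1) ((X.col (p + 1)).d q (q - 1) (X.dh (p + 1) q x.1.1)) = 0
        rw [map_sub, flatD_flatD, flatD_flatOf_succ X _ (sub_add_cancel (q - 1) 1),
          ChainComplex.d_d_apply, dv_dh_apply, map_zero, map_neg]
        abel)
    (by
      intro p q q' x h
      rw [dif_pos h, dif_pos h]
      ext1
      refine Prod.ext ?_ (Prod.ext ?_ ?_)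
      · exact congrArg (fun g => g.hom x.1.1) (X.anticomm p q q')
      · change X.flatD x.1.2.2 - X.flatOf (p + 1) (q - 1) ((X.col (p + 1)).d q (q - 1) x.1.1) +
          (X.flatOf (p + 1) q' ((X.col (p + 1)).d q q' x.1.1) - X.flatD x.1.2.2 - 0) = 0
        obtain rfl : q' = q - 1 := by omega
        abel
      · change 0 + (X.flatD 0 - X.flatOf (p + 1) (q' - 1)
          ((X.col (p + 1)).d q' (q' - 1) ((X.col (p + 1)).d q q' x.1.1))) = 0
        rw [ChainComplex.d_d_apply, map_zero, map_zero, sub_zero, add_zero])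

theorem path_d_apply (X : BCh k) (p : ℕ) {q q' : ℤ} (h : q' + 1 = q) (y : X.pathModule p q) :
    (X.path.col p).d q q' y = X.pathDv p q q' h y := by
  have : (X.path.col p).d q q' = ModuleCat.ofHom (X.pathDv p q q' h) := by
    simp [path, ofModules, h]
  rw [this]
  rfl

/-- The projection of the path object. -/
noncomputable def pathProj (X : BCh k) : X.path ⟶ X :=
  homMk (fun p q => LinearMap.fst k _ _ ∘ₗ (X.pathModule p q).subtype)
    (by
      intro p q q' x h
      exact (congrArg (fun z : X.pathModule p q' => z.1.1) (path_d_apply X p h x)).symm)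
    (fun p q x => rfl)

theorem pathProj_surjective (X : BCh k) (p : ℕ) (q : ℤ) :
    Function.Surjective (app X.pathProj p q) := fun x =>
  ⟨(⟨(x, 0, X.flatOf p q x), fun _ => by simp⟩ : X.pathModule p q), rfl⟩

/-- For p > 0 the coordinates are independent and d_v sends (s, t) to (t, 0), so the kernel column
is contractible: a cycle has t = 0, and (y, 0, s) bounds it. -/
theorem hasDiscLifting_pathProj (X : BCh k) (p : ℕ) (hp : 0 < p) :
    ChainComplex.HasDiscLifting (Hom.f X.pathProj p) := by
  rintro q ⟨⟨x, s, t⟩, hx'⟩ y hx hy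
  have ht : t = 0 := by
    have := hx (q - 1)
    rw [path_d_apply X p (sub_add_cancel q 1)] at this
    exact congrArg (fun z : X.pathModule p (q - 1) => z.1.2.1) this
  subst ht
  refine ⟨(⟨(y, 0, s), fun h => absurd h hp.ne'⟩ : X.pathModule p (q + 1)), ?_, rfl⟩
  rw [path_d_apply X p rfl]
  exact Subtype.ext (Prod.ext hy rfl)

/-- If the projection of the path object of a bicomplex has a section, then the total complex is
acyclic. -/
theorem acyclic_tot_of_section (X : BCh k) (σ : X ⟶ X.path) (hσ : σ ≫ X.pathProj = 𝟙 X) :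
    (Tot.obj X).Acyclic := by
  intro n
  let σ' (p : ℕ) (q : ℤ) : (X.col p).X q →ₗ[k] X.pathModule p q := (app σ p q).hom
  let h (i : ℕ × ℤ) : (X.col i.1).X i.2 →ₗ[k] X.FlatTot :=
    LinearMap.fst k _ _ ∘ₗ LinearMap.snd k _ _ ∘ₗ (X.pathModule i.1 i.2).subtype ∘ₗ σ' i.1 i.2
  let H : X.FlatTot →ₗ[k] X.FlatTot := DirectSum.toModule k (ℕ × ℤ) X.FlatTot h
  have hH (p q x) : H (X.flatOf p q x) = (σ' p q x).1.2.1 := DirectSum.toModule_lof k _ _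
  have h1 (p q x) : (σ' p q x).1.1 = x :=
    congrArg (fun g => (app g p q).hom x) hσ
  have h2 (p q q' x) (hq : q' + 1 = q) :
      (σ' p q' ((X.col p).d q q' x)).1.2.1 = (σ' p q x).1.2.2 := by
    exact congrArg (fun z : X.pathModule p q' => z.1.2.1)
      ((app_dv_apply σ p q q' x).symm.trans (path_d_apply X p hq _))
  have h3 (p q x) : (σ' p q (X.dh p q x)).1.2.1 =
      X.flatOf (p + 1) q x - X.flatD (σ' (p + 1) q x).1.2.1 - (σ' (p + 1) q x).1.2.2 := by
    have := congrArg (fun z : X.pathModule p q => z.1.2.1) (app_dh_apply σ p q x).symm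
    refine this.trans ?_
    change X.flatOf (p + 1) q (σ' (p + 1) q x).1.1 - _ - _ = _
    rw [h1]
    rfl
  -- H, the second coordinate of the section, is a contraction: column 0 uses the defining condition
  -- of `pathModule`, the others the formula for `pathDh`.
  have hH' (z) : X.flatD (H z) + H (X.flatD z) = z := by
    change (X.flatD ∘ₗ H + H ∘ₗ X.flatD) z = (LinearMap.id : X.FlatTot →ₗ[k] X.FlatTot) z
    congr 1
    refine DirectSum.linearMap_ext k fun ⟨p, q⟩ => LinearMap.ext fun x => ?_
    change X.flatD (H (X.flatOf p q x)) + H (X.flatD (X.flatOf p q x)) = X.flatOf p q x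
    cases p with
    | zero =>
      rw [flatD_flatOf_zero X (sub_add_cancel q 1), hH, hH, h2 _ _ _ _ (sub_add_cancel q 1),
        (σ' 0 q x).2 rfl, h1]
      abel
    | succ p =>
      rw [flatD_flatOf_succ X p (sub_add_cancel q 1), map_add, hH, hH, hH,
        h2 _ _ _ _ (sub_add_cancel q 1), h3]
      abel
  refine exactAt_tot_of_flat X n fun z _ hz => ⟨H z, ?_⟩
  have := hH' z
  rwa [hz, map_zero, add_zero] at this

end BCh

namespace BCh

variable {k : Type u} [CommRing k]

/-! ### Morphisms from boxes -/

section Box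

variable {p : ℕ} {q : ℤ} {A : ℕ → Prop} {B : ℤ → Prop} {h : IsBox p q A B} {X : BCh k}

variable (k h) in
/-- The generator of a box in bidegree `(a, b)`. -/
noncomputable def boxGen (a : ℕ) (b : ℤ) (hab : A a ∧ B b) : ((ofBox (k := k) h).col a).X b :=
  (⟨1, Or.inl hab⟩ : cell k (A a ∧ B b))

theorem boxGen_dv (a : ℕ) {b b' : ℤ} (hb : b' + 1 = b) (hab : A a ∧ B b) (hab' : A a ∧ B b') :
    ((ofBox (k := k) h).col a).d b b' (boxGen k h a b hab) =
      (if a = p then -1 else 1 : k) • boxGen k h a b' hab' := by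
  refine Subtype.ext ?_
  simp only [ofBox, if_pos hb]
  exact if_pos hab'

theorem boxGen_dv_eq_zero (a : ℕ) {b : ℤ} (b' : ℤ) (hab : A a ∧ B b) (hab' : ¬ B b') :
    ((ofBox (k := k) h).col a).d b b' (boxGen k h a b hab) = 0 := by
  obtain ⟨y, hy⟩ : ∃ y : cell k (A a ∧ B b'), ((ofBox h).col a).d b b' (boxGen k h a b hab) = y :=
    ⟨_, rfl⟩
  exact hy.trans (Subtype.ext (y.2.resolve_left fun hh => hab' hh.2))

theorem boxGen_dh (a : ℕ) (b : ℤ) (hab : A (a + 1) ∧ B b) (hab' : A a ∧ B b) :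
    (ofBox (k := k) h).dh a b (boxGen k h (a + 1) b hab) = boxGen k h a b hab' := by
  refine Subtype.ext ?_
  exact (if_pos hab').trans (one_mul 1)

/-- The image of the generator in bidegree `(a, b)`. -/
noncomputable def gen (φ : ofBox (k := k) h ⟶ X) (a : ℕ) (b : ℤ) (hab : A a ∧ B b) :
    (X.col a).X b :=
  app φ a b (boxGen k h a b hab)

theorem app_eq_smul_gen (φ : ofBox (k := k) h ⟶ X) (a : ℕ) (b : ℤ) (hab : A a ∧ B b)
    (x : cell k (A a ∧ B b)) : app φ a b x = x.1 • gen φ a b hab := by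
  have : x = x.1 • (⟨1, Or.inl hab⟩ : cell k (A a ∧ B b)) := by
    ext
    simp
  conv_lhs => rw [this]
  exact (app φ a b).hom.map_smul _ _

theorem gen_comp (φ : ofBox (k := k) h ⟶ X) {Y : BCh k} (f : X ⟶ Y) (a : ℕ) (b : ℤ)
    (hab : A a ∧ B b) : gen (φ ≫ f) a b hab = app f a b (gen φ a b hab) := rfl

theorem ofBox_hom_ext {φ ψ : ofBox (k := k) h ⟶ X} (H : ∀ a b hab, gen φ a b hab = gen ψ a b hab) :
    φ = ψ := by
  refine hom_ext _ _ fun a b => ?_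
  ext x
  by_cases hab : A a ∧ B b
  · exact (app_eq_smul_gen φ a b hab x).trans ((congrArg _ (H a b hab)).trans
      (app_eq_smul_gen ψ a b hab x).symm)
  · obtain ⟨x, hx⟩ := x
    obtain rfl : x = 0 := hx.resolve_left hab
    exact (map_zero (app φ a b).hom).trans (map_zero (app ψ a b).hom).symm

theorem gen_dv (φ : ofBox (k := k) h ⟶ X) (a : ℕ) {b b' : ℤ} (hb : b' + 1 = b) (hab : A a ∧ B b)
    (hab' : A a ∧ B b') :
    (X.col a).d b b' (gen φ a b hab) = (if a = p then -1 else 1 : k) • gen φ a b' hab' :=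
  (app_dv_apply φ a b b' _).trans ((congrArg _ (boxGen_dv a hb hab hab')).trans (map_smul _ _ _))

theorem gen_dv_eq_zero (φ : ofBox (k := k) h ⟶ X) (a : ℕ) {b : ℤ} (b' : ℤ) (hab : A a ∧ B b)
    (hab' : ¬ B b') : (X.col a).d b b' (gen φ a b hab) = 0 :=
  (app_dv_apply φ a b b' _).trans
    ((congrArg _ (boxGen_dv_eq_zero a b' hab hab')).trans (map_zero _))

theorem gen_dh (φ : ofBox (k := k) h ⟶ X) (a : ℕ) (b : ℤ) (hab : A (a + 1) ∧ B b)
    (hab' : A a ∧ B b) : X.dh a b (gen φ (a + 1) b hab) = gen φ a b hab' :=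
  (app_dh_apply φ a b _).trans (congrArg _ (boxGen_dh a b hab hab'))

/-- Morphisms from a box are given by the images of the generators. -/
theorem exists_ofBox_hom (e : ∀ i : ℕ × ℤ, (X.col i.1).X i.2)
    (hv : ∀ a b b', b' + 1 = b → A a → B b → B b' →
      (X.col a).d b b' (e (a, b)) = (if a = p then -1 else 1 : k) • e (a, b'))
    (hv0 : ∀ a b b', b' + 1 = b → A a → B b → ¬ B b' → (X.col a).d b b' (e (a, b)) = 0)
    (hh : ∀ a b, A (a + 1) → A a → B b → X.dh a b (e (a + 1, b)) = e (a, b))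
    (hh0 : ∀ a b, A (a + 1) → ¬ A a → B b → X.dh a b (e (a + 1, b)) = 0) :
    ∃ φ : ofBox (k := k) h ⟶ X, ∀ a b hab, gen φ a b hab = e (a, b) := by
  let f (a : ℕ) (b : ℤ) : cell k (A a ∧ B b) →ₗ[k] (X.col a).X b :=
    LinearMap.toSpanSingleton k _ (e (a, b)) ∘ₗ (cell k (A a ∧ B b)).subtype
  refine ⟨homMk f ?_ ?_, fun a b hab => one_smul k _⟩
  · rintro a b b' ⟨x, hx⟩ hb
    simp only [ofBox, if_pos hb]
    change (X.col a).d b b' (x • e (a, b)) =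
      (cellMap (A a ∧ B b) (A a ∧ B b') (if a = p then -1 else 1) ⟨x, hx⟩).1 • e (a, b')
    rcases hx with hab | rfl
    · rw [map_smul]
      by_cases hb' : B b'
      · rw [hv a b b' hb hab.1 hab.2 hb', smul_smul]
        simp [cellMap, hab.1, hb']
      · rw [hv0 a b b' hb hab.1 hab.2 hb']
        simp [cellMap, hb']
    · simp [cellMap]
  · rintro a b ⟨x, hx⟩
    change X.dh a b (x • e (a + 1, b)) =
      (cellMap (A (a + 1) ∧ B b) (A a ∧ B b) 1 ⟨x, hx⟩).1 • e (a, b)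
    rcases hx with hab | rfl
    · rw [map_smul]
      by_cases ha : A a
      · rw [hh a b hab.1 ha hab.2]
        simp [cellMap, ha, hab.2]
      · rw [hh0 a b hab.1 ha hab.2]
        simp [cellMap, ha]
    · simp [cellMap]

end Box

/-! ### Universal properties of discs, boundaries and spheres. -/

section Discs

variable {X : BCh k}

/-- The disc is free on its generator in the top right corner. The other generators must go to -d_v
x (the sign of the disc in its right column), d_h x and d_v d_h x. -/
theorem exists_disc_hom (p : ℕ) (q : ℤ) (x : (X.col (p + 1)).X (q + 1)) :
    ∃ φ : disc k (p + 1) (q + 1) ⟶ X, gen φ (p + 1) (q + 1) ⟨Or.inl rfl, Or.inl rfl⟩ = x := by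
  let e : ∀ i : ℕ × ℤ, (X.col i.1).X i.2 :=
    Function.update (Function.update (Function.update (Function.update (fun _ => 0)
      (p + 1, q + 1) x) (p + 1, q) (-(X.col (p + 1)).d (q + 1) q x)) (p, q + 1) (X.dh p (q + 1) x))
      (p, q) ((X.col p).d (q + 1) q (X.dh p (q + 1) x))
  have e1 : e (p + 1, q + 1) = x := by simp [e, Function.update_of_ne]
  have e2 : e (p + 1, q) = -(X.col (p + 1)).d (q + 1) q x := by simp [e, Function.update_of_ne]
  have e3 : e (p, q + 1) = X.dh p (q + 1) x := by simp [e, Function.update_of_ne]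
  have e4 : e (p, q) = (X.col p).d (q + 1) q (X.dh p (q + 1) x) := by simp [e]
  obtain ⟨φ, hφ⟩ := exists_ofBox_hom (p := p + 1) (q := q + 1)
    (A := fun a => a = p + 1 ∨ a + 1 = p + 1)
    (B := fun b => b = q + 1 ∨ b + 1 = q + 1) (h := ⟨fun _ h => h, fun _ h => h⟩) e (by
      rintro a b b' hb ha hb1 hb2
      obtain rfl : b' = q := by omega
      obtain rfl : b = b' + 1 := by omega
      rcases ha with rfl | ha
      · rw [e1, e2, if_pos rfl, neg_one_smul, neg_neg]
      · obtain rfl : a = p := by omega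
        rw [e3, e4, if_neg (by omega), one_smul]) (by
      rintro a b b' hb ha hb1 hb2
      obtain rfl : b = q := by omega
      rcases ha with rfl | ha
      · rw [e2, map_neg, ChainComplex.d_d_apply, neg_zero]
      · obtain rfl : a = p := by omega
        rw [e4, ChainComplex.d_d_apply]) (by
      rintro a b ha ha' hb
      obtain rfl : a = p := by omega
      rcases hb with rfl | hb
      · rw [e1, e3]
      · obtain rfl : b = q := by omega
        rw [e2, e4, map_neg, dv_dh_apply]) (by
      rintro a b ha ha' hb
      obtain rfl : a + 1 = p := by omega
      rcases hb with rfl | hb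
      · rw [e3, dh_dh_apply]
      · obtain rfl : b = q := by omega
        rw [e4, dv_dh_apply, map_neg, dh_dh_apply, neg_zero])
  exact ⟨φ, (hφ _ _ _).trans e1⟩

theorem disc_gen_bot {p : ℕ} {q : ℤ} (φ : disc k (p + 1) (q + 1) ⟶ X) (hab) :
    gen φ (p + 1) q hab =
      -(X.col (p + 1)).d (q + 1) q (gen φ (p + 1) (q + 1) ⟨Or.inl rfl, Or.inl rfl⟩) := by
  rw [gen_dv φ (p + 1) rfl _ hab, if_pos rfl, neg_one_smul, neg_neg]

theorem disc_hom_ext {p : ℕ} {q : ℤ} {φ ψ : disc k (p + 1) (q + 1) ⟶ X}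
    (H : gen φ (p + 1) (q + 1) ⟨Or.inl rfl, Or.inl rfl⟩ =
      gen ψ (p + 1) (q + 1) ⟨Or.inl rfl, Or.inl rfl⟩) : φ = ψ := by
  have H' (hab) : gen φ (p + 1) q hab = gen ψ (p + 1) q hab := by
    rw [disc_gen_bot, disc_gen_bot, H]
  refine ofBox_hom_ext fun a b hab => ?_
  rcases hab with ⟨rfl | ha, rfl | hb⟩
  · exact H
  · obtain rfl : b = q := by omega
    exact H' _
  · obtain rfl : a = p := by omega
    rw [← gen_dh φ a _ ⟨Or.inl rfl, Or.inl rfl⟩, H, gen_dh ψ]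
  · obtain rfl : a = p := by omega
    obtain rfl : b = q := by omega
    rw [← gen_dh φ a _ ⟨Or.inl rfl, Or.inr rfl⟩, H', gen_dh ψ]

theorem exists_vBdDisc_hom (p : ℕ) (q : ℤ) (x : (X.col (p + 1)).X q)
    (hx : ∀ q', (X.col (p + 1)).d q q' x = 0) :
    ∃ φ : vBdDisc k (p + 1) (q + 1) ⟶ X, gen φ (p + 1) q ⟨Or.inl rfl, rfl⟩ = x := by
  let e : ∀ i : ℕ × ℤ, (X.col i.1).X i.2 :=
    Function.update (Function.update (fun _ => 0) (p + 1, q) x) (p, q) (X.dh p q x)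
  have e1 : e (p + 1, q) = x := by simp [e, Function.update_of_ne]
  have e2 : e (p, q) = X.dh p q x := by simp [e]
  obtain ⟨φ, hφ⟩ := exists_ofBox_hom (p := p + 1) (q := q + 1)
    (A := fun a => a = p + 1 ∨ a + 1 = p + 1)
    (B := fun b => b + 1 = q + 1) (h := ⟨fun _ h => h, fun _ h => Or.inr h⟩) e (by
      rintro a b b' hb ha hb1 hb2
      omega) (by
      rintro a b b' hb ha hb1 hb2
      obtain rfl : b = q := by omega
      rcases ha with rfl | ha
      · rw [e1, hx]
      · obtain rfl : a = p := by omega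
        rw [e2, dv_dh_apply, hx, map_zero, neg_zero]) (by
      rintro a b ha ha' hb
      obtain rfl : a = p := by omega
      obtain rfl : b = q := by omega
      rw [e1, e2]) (by
      rintro a b ha ha' hb
      obtain rfl : a + 1 = p := by omega
      obtain rfl : b = q := by omega
      rw [e2, dh_dh_apply])
  exact ⟨φ, (hφ _ _ _).trans e1⟩

theorem vBdDisc_hom_ext {p : ℕ} {q : ℤ} {φ ψ : vBdDisc k (p + 1) (q + 1) ⟶ X}
    (H : gen φ (p + 1) q ⟨Or.inl rfl, rfl⟩ = gen ψ (p + 1) q ⟨Or.inl rfl, rfl⟩) : φ = ψ := by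
  refine ofBox_hom_ext fun a b hab => ?_
  rcases hab with ⟨rfl | ha, hb⟩
  · obtain rfl : b = q := by omega
    exact H
  · obtain rfl : a = p := by omega
    obtain rfl : b = q := by omega
    rw [← gen_dh φ a _ ⟨Or.inl rfl, rfl⟩, H, gen_dh ψ]

theorem exists_hBdDisc_hom (q : ℤ) (x : (X.col 0).X (q + 1)) :
    ∃ φ : hBdDisc k 1 (q + 1) ⟶ X, gen φ 0 (q + 1) ⟨rfl, Or.inl rfl⟩ = x := by
  let e : ∀ i : ℕ × ℤ, (X.col i.1).X i.2 :=
    Function.update (Function.update (fun _ => 0) (0, q + 1) x) (0, q) ((X.col 0).d (q + 1) q x)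
  have e1 : e (0, q + 1) = x := by simp [e, Function.update_of_ne]
  have e2 : e (0, q) = (X.col 0).d (q + 1) q x := by simp [e]
  obtain ⟨φ, hφ⟩ := exists_ofBox_hom (p := 1) (q := q + 1) (A := fun a => a + 1 = 1)
    (B := fun b => b = q + 1 ∨ b + 1 = q + 1) (h := ⟨fun _ h => Or.inr h, fun _ h => h⟩) e (by
      rintro a b b' hb ha hb1 hb2
      obtain rfl : a = 0 := by omega
      obtain rfl : b' = q := by omega
      obtain rfl : b = b' + 1 := by omega
      rw [e1, e2, if_neg (by omega), one_smul]) (by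
      rintro a b b' hb ha hb1 hb2
      obtain rfl : a = 0 := by omega
      obtain rfl : b = q := by omega
      rw [e2, ChainComplex.d_d_apply]) (by
      rintro a b ha ha' hb
      omega) (by
      rintro a b ha ha' hb
      omega)
  exact ⟨φ, (hφ _ _ _).trans e1⟩

theorem hBdDisc_gen_bot {q : ℤ} (φ : hBdDisc k 1 (q + 1) ⟶ X) (hab) :
    gen φ 0 q hab = (X.col 0).d (q + 1) q (gen φ 0 (q + 1) ⟨rfl, Or.inl rfl⟩) := by
  rw [gen_dv φ 0 rfl _ hab, if_neg (by omega), one_smul]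

theorem hBdDisc_hom_ext {q : ℤ} {φ ψ : hBdDisc k 1 (q + 1) ⟶ X}
    (H : gen φ 0 (q + 1) ⟨rfl, Or.inl rfl⟩ = gen ψ 0 (q + 1) ⟨rfl, Or.inl rfl⟩) : φ = ψ := by
  refine ofBox_hom_ext fun a b hab => ?_
  rcases hab with ⟨ha, rfl | hb⟩
  · obtain rfl : a = 0 := by omega
    exact H
  · obtain rfl : a = 0 := by omega
    obtain rfl : b = q := by omega
    rw [hBdDisc_gen_bot, hBdDisc_gen_bot, H]

/-- The sphere in the generating inclusion sits in degree q + 1 - 1, which is q only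
propositionally; hence the separate q'. -/
theorem exists_sphere_hom {q q' : ℤ} (hq : q = q') (x : (X.col 0).X q)
    (hx : ∀ r, (X.col 0).d q r x = 0) :
    ∃ φ : sphere k 0 q' ⟶ X, gen φ 0 q ⟨rfl, hq⟩ = x := by
  subst hq
  let e : ∀ i : ℕ × ℤ, (X.col i.1).X i.2 := Function.update (fun _ => 0) (0, q) x
  have e1 : e (0, q) = x := by simp [e]
  obtain ⟨φ, hφ⟩ := exists_ofBox_hom (p := 0 + 1) (q := q + 1) (A := fun a => a = 0)
    (B := fun b => b = q) (h := ⟨fun _ h => Or.inr (by omega), fun _ h => Or.inr (by omega)⟩) e (by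
      rintro a b b' hb ha hb1 hb2
      omega) (by
      rintro _ _ b' hb rfl rfl hb2
      rw [e1, hx]) (by
      rintro a b ha ha' hb
      omega) (by
      rintro a b ha ha' hb
      omega)
  exact ⟨φ, (hφ _ _ _).trans e1⟩

theorem sphere_hom_ext {q q' : ℤ} (hq : q = q') {φ ψ : sphere k 0 q' ⟶ X}
    (H : gen φ 0 q ⟨rfl, hq⟩ = gen ψ 0 q ⟨rfl, hq⟩) : φ = ψ := by
  subst hq
  refine ofBox_hom_ext fun a b hab => ?_
  obtain ⟨rfl, rfl⟩ := hab
  exact H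

end Discs

end BCh

namespace BCh

variable {k : Type u} [CommRing k]

/-! ### The right lifting properties -/

section Lifting

variable {X Y : BCh k} (f : X ⟶ Y)

/-- A square is a vertical cycle x together with an element y of the target such that -d_v y = f(x),
and a lift is a common refinement. Replacing y by -y absorbs the sign of the disc. -/
theorem hasLiftingProperty_vBdDiscIncl_iff (p : ℕ) :
    (∀ q, HasLiftingProperty (vBdDiscIncl k (p + 1) q) f) ↔
      ChainComplex.HasDiscLifting (Hom.f f (p + 1)) := by
  constructor
  · intro h q x y hx hxy
    have := h (q + 1)
    obtain ⟨u, hu⟩ := exists_vBdDisc_hom p q x hx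
    obtain ⟨v, hv⟩ := exists_disc_hom p q (-y)
    have sq : CommSq u (vBdDiscIncl k (p + 1) (q + 1)) f v := ⟨vBdDisc_hom_ext (by
      refine (gen_comp u f _ _ _).trans ?_
      rw [hu]
      refine Eq.trans ?_ (disc_gen_bot v ⟨Or.inl rfl, Or.inr rfl⟩).symm
      rw [hv, map_neg, neg_neg, hxy])⟩
    refine ⟨-gen sq.lift (p + 1) (q + 1) ⟨Or.inl rfl, Or.inl rfl⟩, ?_, ?_⟩
    · rw [map_neg, ← disc_gen_bot sq.lift ⟨Or.inl rfl, Or.inr rfl⟩]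
      refine Eq.trans ?_ hu
      exact congrArg (fun u : vBdDisc k (p + 1) (q + 1) ⟶ X => gen u (p + 1) q ⟨Or.inl rfl, rfl⟩)
        sq.fac_left
    · rw [map_neg, neg_eq_iff_eq_neg]
      refine Eq.trans ?_ hv
      exact congrArg (fun v : disc k (p + 1) (q + 1) ⟶ Y =>
        gen v (p + 1) (q + 1) ⟨Or.inl rfl, Or.inl rfl⟩) sq.fac_right
  · intro h q
    obtain ⟨q, rfl⟩ : ∃ r, q = r + 1 := ⟨q - 1, by ring⟩
    refine ⟨fun {u v} sq => ?_⟩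
    obtain ⟨x', hx', hy'⟩ := h q (gen u (p + 1) q ⟨Or.inl rfl, rfl⟩)
      (-gen v (p + 1) (q + 1) ⟨Or.inl rfl, Or.inl rfl⟩)
      (ChainComplex.d_apply_eq_zero (sub_add_cancel q 1)
        (gen_dv_eq_zero u (p + 1) (q - 1) ⟨Or.inl rfl, rfl⟩ (by omega)))
      (by
        rw [map_neg, ← disc_gen_bot v ⟨Or.inl rfl, Or.inr rfl⟩]
        exact congrArg (fun u : vBdDisc k (p + 1) (q + 1) ⟶ Y => gen u (p + 1) q ⟨Or.inl rfl, rfl⟩)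
          sq.w.symm)
    obtain ⟨w, hw⟩ := exists_disc_hom p q (-x')
    refine ⟨⟨⟨w, vBdDisc_hom_ext ?_, disc_hom_ext ?_⟩⟩⟩
    · refine (disc_gen_bot w ⟨Or.inl rfl, Or.inr rfl⟩).trans ?_
      rw [hw, map_neg, neg_neg, hx']
    · refine (congrArg (app f (p + 1) (q + 1)) hw).trans ?_
      rw [map_neg, neg_eq_iff_eq_neg]
      exact hy'

theorem hasLiftingProperty_sphereIncl_iff :
    (∀ q, HasLiftingProperty (sphereIncl k q) f) ↔ ChainComplex.HasDiscLifting (Hom.f f 0) := by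
  constructor
  · intro h q x y hx hxy
    have := h (q + 1)
    have hq : q = q + 1 - 1 := by ring
    obtain ⟨u, hu⟩ := exists_sphere_hom hq x hx
    obtain ⟨v, hv⟩ := exists_hBdDisc_hom q y
    have sq : CommSq u (sphereIncl k (q + 1)) f v := ⟨sphere_hom_ext hq (by
      refine (gen_comp u f _ _ _).trans ?_
      rw [hu]
      refine Eq.trans ?_ (hBdDisc_gen_bot v ⟨rfl, Or.inr rfl⟩).symm
      rw [hv, hxy])⟩
    refine ⟨gen sq.lift 0 (q + 1) ⟨rfl, Or.inl rfl⟩, ?_, ?_⟩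
    · rw [← hBdDisc_gen_bot sq.lift ⟨rfl, Or.inr rfl⟩]
      refine Eq.trans ?_ hu
      exact congrArg (fun u : sphere k 0 (q + 1 - 1) ⟶ X => gen u 0 q ⟨rfl, hq⟩) sq.fac_left
    · refine Eq.trans ?_ hv
      exact congrArg (fun v : hBdDisc k 1 (q + 1) ⟶ Y => gen v 0 (q + 1) ⟨rfl, Or.inl rfl⟩)
        sq.fac_right
  · intro h q
    obtain ⟨q, rfl⟩ : ∃ r, q = r + 1 := ⟨q - 1, by ring⟩
    have hq : q = q + 1 - 1 := by ring
    refine ⟨fun {u v} sq => ?_⟩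
    obtain ⟨x', hx', hy'⟩ := h q (gen u 0 q ⟨rfl, hq⟩) (gen v 0 (q + 1) ⟨rfl, Or.inl rfl⟩)
      (ChainComplex.d_apply_eq_zero (sub_add_cancel q 1)
        (gen_dv_eq_zero u 0 (q - 1) ⟨rfl, hq⟩ (by omega)))
      (by
        rw [← hBdDisc_gen_bot v ⟨rfl, Or.inr rfl⟩]
        exact congrArg (fun u : sphere k 0 (q + 1 - 1) ⟶ Y => gen u 0 q ⟨rfl, hq⟩) sq.w.symm)
    obtain ⟨w, hw⟩ := exists_hBdDisc_hom q x'
    refine ⟨⟨⟨w, sphere_hom_ext hq ?_, hBdDisc_hom_ext ?_⟩⟩⟩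
    · refine (hBdDisc_gen_bot w ⟨rfl, Or.inr rfl⟩).trans ?_
      rw [hw, hx']
    · exact (congrArg (app f 0 (q + 1)) hw).trans hy'

theorem zero_hom_ext {φ ψ : zero k ⟶ X} : φ = ψ := by
  refine hom_ext _ _ fun p q => ?_
  ext x
  obtain rfl : x = 0 := rfl
  exact (map_zero (app φ p q).hom).trans (map_zero (app ψ p q).hom).symm

theorem hasLiftingProperty_fromZero_iff :
    (∀ q, HasLiftingProperty (fromZero k (hBdDisc k 1 q)) f) ↔
      ∀ q, Function.Surjective (app f 0 q) := by
  constructor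
  · intro h q y
    obtain ⟨q, rfl⟩ : ∃ r, q = r + 1 := ⟨q - 1, by ring⟩
    have := h (q + 1)
    obtain ⟨v, hv⟩ := exists_hBdDisc_hom q y
    have sq : CommSq (fromZero k X) (fromZero k (hBdDisc k 1 (q + 1))) f v := ⟨zero_hom_ext⟩
    refine ⟨gen sq.lift 0 (q + 1) ⟨rfl, Or.inl rfl⟩, Eq.trans ?_ hv⟩
    exact congrArg (fun v : hBdDisc k 1 (q + 1) ⟶ Y => gen v 0 (q + 1) ⟨rfl, Or.inl rfl⟩)
        sq.fac_right
  · intro h q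
    obtain ⟨q, rfl⟩ : ∃ r, q = r + 1 := ⟨q - 1, by ring⟩
    refine ⟨fun {u v} sq => ?_⟩
    obtain ⟨x, hx⟩ := h (q + 1) (gen v 0 (q + 1) ⟨rfl, Or.inl rfl⟩)
    obtain ⟨w, hw⟩ := exists_hBdDisc_hom q x
    refine ⟨⟨⟨w, zero_hom_ext, hBdDisc_hom_ext ?_⟩⟩⟩
    exact (congrArg (app f 0 (q + 1)) hw).trans hx

theorem itot_rlp_iff : (ITot k).rlp f ↔ ∀ p, ChainComplex.HasDiscLifting (Hom.f f p) := by
  constructor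
  · rintro h (_ | p)
    · exact (hasLiftingProperty_sphereIncl_iff f).1 fun q => h _ (Or.inl (.mk q))
    · exact (hasLiftingProperty_vBdDiscIncl_iff f p).1 fun q =>
        h _ (Or.inr (.mk (f := fun i : {p : ℕ // 0 < p} × ℤ => vBdDiscIncl k i.1.1 i.2)
          (⟨p + 1, p.succ_pos⟩, q)))
  · rintro h A B g hg
    rcases (hg : _ ∨ _) with hg | hg
    · obtain ⟨q⟩ := hg
      exact (hasLiftingProperty_sphereIncl_iff f).2 (h 0) q
    · obtain ⟨⟨⟨p, hp⟩, q⟩⟩ := hg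
      obtain ⟨p, rfl⟩ := Nat.exists_eq_add_one.2 hp
      exact (hasLiftingProperty_vBdDiscIncl_iff f p).2 (h _) q

theorem jtot_rlp_iff : (JTot k).rlp f ↔
    (∀ q, Function.Surjective (app f 0 q)) ∧
      ∀ p, 0 < p → ChainComplex.HasDiscLifting (Hom.f f p) := by
  constructor
  · refine fun h => ⟨(hasLiftingProperty_fromZero_iff f).1 fun q => h _ (Or.inl (.mk q)), ?_⟩
    intro p hp
    obtain ⟨p, rfl⟩ := Nat.exists_eq_add_one.2 hp
    exact (hasLiftingProperty_vBdDiscIncl_iff f p).1 fun q =>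
      h _ (Or.inr (.mk (f := fun i : {p : ℕ // 0 < p} × ℤ => vBdDiscIncl k i.1.1 i.2)
          (⟨p + 1, p.succ_pos⟩, q)))
  · rintro ⟨h, h'⟩ A B g hg
    rcases (hg : _ ∨ _) with hg | hg
    · obtain ⟨q⟩ := hg
      exact (hasLiftingProperty_fromZero_iff f).2 h q
    · obtain ⟨⟨⟨p, hp⟩, q⟩⟩ := hg
      obtain ⟨p, rfl⟩ := Nat.exists_eq_add_one.2 hp
      exact (hasLiftingProperty_vBdDiscIncl_iff f p).2 (h' _ hp) q

theorem quasiIso_col_iff (p : ℕ) :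
    QuasiIso (Hom.f f p) ↔ ∀ q, IsIso (vHomologyMap f p q) := by
  simp only [quasiIso_iff, quasiIsoAt_iff_isIso_homologyMap]

theorem itot_rlp_iff_quasiIso : (ITot k).rlp f ↔
    (∀ p q, Function.Surjective (app f p q)) ∧ ∀ p, QuasiIso (Hom.f f p) := by
  simp only [itot_rlp_iff, ChainComplex.hasDiscLifting_iff, forall_and]

/-- Surjectivity in positive columns is part of disc lifting; in column 0 it comes from the maps 0 →
∂_h D^{1,q}. -/
theorem jtot_rlp_iff_quasiIso : (JTot k).rlp f ↔
    (∀ p q, Function.Surjective (app f p q)) ∧ ∀ p, 0 < p → QuasiIso (Hom.f f p) := by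
  simp only [jtot_rlp_iff, ChainComplex.hasDiscLifting_iff]
  constructor
  · rintro ⟨h0, h⟩
    refine ⟨fun p => ?_, fun p hp => (h p hp).2⟩
    cases p with
    | zero => exact h0
    | succ p => exact (h _ p.succ_pos).1
  · rintro ⟨h0, h⟩
    exact ⟨h0 0, fun p hp => ⟨h0 p, h p hp⟩⟩

theorem itot_rlp_le_jtot_rlp : (ITot k).rlp ≤ (JTot k).rlp := fun _ _ f hf =>
  (jtot_rlp_iff_quasiIso f).2
    ⟨((itot_rlp_iff_quasiIso f).1 hf).1, fun p _ => ((itot_rlp_iff_quasiIso f).1 hf).2 p⟩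

end Lifting

/-! ### Kernels, cokernels and quasi-isomorphisms -/

section

variable {X Y : BCh k} (f : X ⟶ Y)

theorem shortExact_kernel [Epi f] :
    (ShortComplex.mk _ _ (kernel.condition f)).ShortExact :=
  { exact := ShortComplex.exact_kernel f }

theorem shortExact_cokernel [Mono f] :
    (ShortComplex.mk _ _ (cokernel.condition f)).ShortExact :=
  { exact := ShortComplex.exact_cokernel f }

theorem quasiIso_col_iff_kernel [Epi f] (p : ℕ) :
    QuasiIso (Hom.f f p) ↔ ((kernel f).col p).Acyclic :=
  ChainComplex.quasiIso_g_iff_of_shortExact (shortExact_col (shortExact_kernel f) p)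

theorem quasiIso_tot_iff_kernel [Epi f] :
    QuasiIso (Tot.map f) ↔ (Tot.obj (kernel f)).Acyclic :=
  ChainComplex.quasiIso_g_iff_of_shortExact (shortExact_tot (shortExact_kernel f))

theorem quasiIso_tot_iff_cokernel [Mono f] :
    QuasiIso (Tot.map f) ↔ (Tot.obj (cokernel f)).Acyclic :=
  ChainComplex.quasiIso_f_iff_of_shortExact (shortExact_tot (shortExact_cokernel f))

theorem epi_of_jtot_rlp (hf : (JTot k).rlp f) : Epi f :=
  (epi_iff f).2 ((jtot_rlp_iff_quasiIso f).1 hf).1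

/-- The trivial fibrations are the fibrations which are weak equivalences. -/
theorem itot_rlp_iff_jtot_rlp_and_quasiIso :
    (ITot k).rlp f ↔ (JTot k).rlp f ∧ QuasiIso (Tot.map f) := by
  -- The kernel of a fibration has acyclic positive columns, so `acyclic_tot_iff` compares its Tot
  -- with its column 0.
  have key (hf : (JTot k).rlp f) : QuasiIso (Tot.map f) ↔ QuasiIso (Hom.f f 0) := by
    have := epi_of_jtot_rlp f hf
    rw [quasiIso_tot_iff_kernel, quasiIso_col_iff_kernel, acyclic_tot_iff]
    intro p hp
    rw [← quasiIso_col_iff_kernel]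
    exact ((jtot_rlp_iff_quasiIso f).1 hf).2 p hp
  constructor
  · intro h
    exact ⟨itot_rlp_le_jtot_rlp _ h,
      (key (itot_rlp_le_jtot_rlp _ h)).2 (((itot_rlp_iff_quasiIso f).1 h).2 0)⟩
  · rintro ⟨h, h'⟩
    have h1 := (jtot_rlp_iff_quasiIso f).1 h
    refine (itot_rlp_iff_quasiIso f).2 ⟨h1.1, fun p => ?_⟩
    cases p with
    | zero => exact (key h).1 h'
    | succ p => exact h1.2 _ p.succ_pos

end

end BCh

namespace BCh

variable {k : Type u} [CommRing k]

/-! ### Bicomplexes cogenerated by a module -/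

section Cofree

variable (M N : Type u) [AddCommGroup M] [Module k M] [AddCommGroup N] [Module k N]

/-- The vertical differential of `cofree`. -/
def cofreeDv : M × M × M × M →ₗ[k] M × M × M × M where
  -- If the coordinates are the values of g at x, d_v x, d_h x, d_v d_h x, these are its values for
  -- d_v x; the sign is that of d_h d_v = -d_v d_h.
  toFun x := (x.2.1, 0, -x.2.2.2, 0)
  map_add' x y := by ext <;> simp [add_comm]
  map_smul' c x := by ext <;> simp

/-- The horizontal differential of `cofree`. -/
def cofreeDh : M × M × M × M →ₗ[k] M × M × M × M where
  toFun x := (x.2.2.1, x.2.2.2, 0, 0)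
  map_add' x y := by ext <;> simp
  map_smul' c x := by ext <;> simp

variable (k) in
/-- The bicomplex such that morphisms to it are the same thing as families of linear
maps to `M`: the components of the image of `x` are the images of `x`, `d_v x`, `d_h x` and
`d_v d_h x`. -/
noncomputable def cofree : BCh k :=
  ofModules (fun _ _ => M × M × M × M) (fun _ _ _ => cofreeDv M) (fun _ _ => cofreeDh M)
    (fun p q q' q'' x _ _ => by simp [cofreeDv]) (fun p q x => by simp [cofreeDh])
    (fun p q q' x _ => by simp [cofreeDv, cofreeDh])

theorem cofree_d_apply (p : ℕ) {q q' : ℤ} (h : q' + 1 = q) (x : M × M × M × M) :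
    ((cofree k M).col p).d q q' x = cofreeDv (k := k) M x := by
  have : ((cofree k M).col p).d q q' = ModuleCat.ofHom (cofreeDv M) := by
    simp [cofree, ofModules, h]
  rw [this]
  rfl

variable {M N}

/-- The morphism `cofree k M ⟶ cofree k N` induced by a linear map. -/
noncomputable def cofreeMap (φ : M →ₗ[k] N) : cofree k M ⟶ cofree k N :=
  homMk (fun _ _ => φ.prodMap (φ.prodMap (φ.prodMap φ)))
    (by
      intro p q q' (x : M × M × M × M) h
      refine (cofree_d_apply N p h _).trans
        (Eq.trans ?_ (congrArg (φ.prodMap (φ.prodMap (φ.prodMap φ)))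
          (cofree_d_apply M p h x)).symm)
      simp [cofreeDv]
      rfl)
    (by
      intro p q (x : M × M × M × M)
      change cofreeDh (k := k) N (φ.prodMap (φ.prodMap (φ.prodMap φ)) x) =
        φ.prodMap (φ.prodMap (φ.prodMap φ)) (cofreeDh (k := k) M x)
      simp [cofreeDh])

/-- Vertical cycles have the form (a, 0, c, 0), with primitives (m₁, a, m₃, -c) for arbitrary m₁ and
m₃. These two are chosen over the given n₁ and n₃; the other coordinates already match. -/
theorem hasDiscLifting_cofreeMap {φ : M →ₗ[k] N} (hφ : Function.Surjective φ) (p : ℕ) :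
    ChainComplex.HasDiscLifting (Hom.f (cofreeMap φ) p) := by
  rintro q (x : M × M × M × M) (y : N × N × N × N) hx hy
  obtain ⟨a, b, c, d⟩ := x
  obtain ⟨n₁, n₂, n₃, n₄⟩ := y
  have hx' := (cofree_d_apply (k := k) M p (sub_add_cancel q 1)
    (a, b, c, d)).symm.trans (hx (q - 1))
  have hy' := (cofree_d_apply (k := k) N p (rfl : q + 1 = q + 1) (n₁, n₂, n₃, n₄)).symm.trans hy
  change ((b, 0, -d, 0) : M × M × M × M) = (0, 0, 0, 0) at hx'
  change ((n₂, 0, -n₄, 0) : N × N × N × N) = (φ a, φ b, φ c, φ d) at hy'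
  simp only [Prod.mk.injEq] at hx' hy'
  obtain ⟨m₁, rfl⟩ := hφ n₁
  obtain ⟨m₃, rfl⟩ := hφ n₃
  refine ⟨((m₁, a, m₃, -c) : M × M × M × M), ?_, ?_⟩
  · refine (cofree_d_apply (k := k) M p rfl (m₁, a, m₃, -c)).trans ?_
    change ((a, 0, - -c, 0) : M × M × M × M) = (a, b, c, d)
    rw [neg_neg, hx'.1, neg_eq_zero.1 hx'.2.2.1]
  · change ((φ m₁, φ a, φ m₃, φ (-c)) : N × N × N × N) = (φ m₁, n₂, φ m₃, n₄)
    rw [hy'.1, map_neg, ← hy'.2.2.1, neg_neg]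

variable {X Y : BCh k}

/-- The composition of a family of linear maps with the horizontal differential. -/
noncomputable def compDh (g : ∀ p q, (X.col p).X q →ₗ[k] M) : ∀ p q, (X.col p).X q →ₗ[k] M
  | 0, _ => 0
  | p + 1, q => g p q ∘ₗ (X.dh p q).hom

/-- The composition of a family of linear maps with the vertical differential. -/
noncomputable def compDv (g : ∀ p q, (X.col p).X q →ₗ[k] M) (p : ℕ) (q : ℤ) :
    (X.col p).X q →ₗ[k] M :=
  g p (q - 1) ∘ₗ ((X.col p).d q (q - 1)).hom

theorem compDv_apply (g : ∀ p q, (X.col p).X q →ₗ[k] M) (p : ℕ) {q q' : ℤ} (h : q' + 1 = q)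
    (x : (X.col p).X q) : compDv g p q x = g p q' ((X.col p).d q q' x) := by
  obtain rfl : q' = q - 1 := by omega
  rfl

theorem compDv_d (g : ∀ p q, (X.col p).X q →ₗ[k] M) (p : ℕ) (q q' : ℤ)
    (x : (X.col p).X q) : compDv g p q' ((X.col p).d q q' x) = 0 := by
  change g p (q' - 1) ((X.col p).d q' (q' - 1) ((X.col p).d q q' x)) = 0
  rw [ChainComplex.d_d_apply, map_zero]

theorem compDh_dh (g : ∀ p q, (X.col p).X q →ₗ[k] M) (p : ℕ) (q : ℤ)
    (x : (X.col (p + 1)).X q) : compDh g p q (X.dh p q x) = 0 := by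
  cases p with
  | zero => rfl
  | succ p =>
    change g p q (X.dh p q (X.dh (p + 1) q x)) = 0
    rw [dh_dh_apply, map_zero]

theorem compDh_d (g : ∀ p q, (X.col p).X q →ₗ[k] M) (p : ℕ) {q q' : ℤ} (h : q' + 1 = q)
    (x : (X.col p).X q) :
    compDh g p q' ((X.col p).d q q' x) = -compDh (compDv g) p q x := by
  cases p with
  | zero => exact neg_zero.symm
  | succ p =>
    change g p q' (X.dh p q' ((X.col (p + 1)).d q q' x)) = -compDv g p q (X.dh p q x)
    rw [compDv_apply g p h, dv_dh_apply, map_neg, neg_neg]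

/-- The morphism to `cofree k M` corresponding to a family of linear maps. -/
noncomputable def cofreeLift (g : ∀ p q, (X.col p).X q →ₗ[k] M) : X ⟶ cofree k M :=
  homMk (fun p q => (g p q).prod ((compDv g p q).prod
      ((compDh g p q).prod (compDh (compDv g) p q))))
    (by
      intro p q q' x h
      refine (cofree_d_apply M p h _).trans ?_
      change (compDv g p q x, (0 : M), -compDh (compDv g) p q x, (0 : M)) =
        (g p q' ((X.col p).d q q' x), compDv g p q' ((X.col p).d q q' x),
          compDh g p q' ((X.col p).d q q' x), compDh (compDv g) p q' ((X.col p).d q q' x))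
      have h4 : compDh (compDv g) p q' ((X.col p).d q q' x) = 0 := by
        cases p with
        | zero => rfl
        | succ p =>
          change compDv g p q' (X.dh p q' ((X.col (p + 1)).d q q' x)) = 0
          have : X.dh p q' ((X.col (p + 1)).d q q' x) = -((X.col p).d q q' (X.dh p q x)) := by
            rw [dv_dh_apply, neg_neg]
          rw [this, map_neg, compDv_d, neg_zero]
      rw [compDv_d, compDv_apply g p h, compDh_d g p h, h4])
    (by
      intro p q x
      change (g p q (X.dh p q x), compDv g p q (X.dh p q x), (0 : M), (0 : M)) =
        (g p q (X.dh p q x), compDv g p q (X.dh p q x), compDh g p q (X.dh p q x),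
          compDh (compDv g) p q (X.dh p q x))
      rw [compDh_dh, compDh_dh])

theorem compDh_comp {i : X ⟶ Y} {φ : M →ₗ[k] N} {g : ∀ p q, (X.col p).X q →ₗ[k] M}
    {g' : ∀ p q, (Y.col p).X q →ₗ[k] N} (h : ∀ p q x, φ (g p q x) = g' p q (app i p q x))
    (p : ℕ) (q : ℤ) (x : (X.col p).X q) : φ (compDh g p q x) = compDh g' p q (app i p q x) := by
  cases p with
  | zero => exact map_zero φ
  | succ p =>
    change φ (g p q (X.dh p q x)) = g' p q (Y.dh p q (app i (p + 1) q x))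
    rw [h, app_dh_apply]

theorem compDv_comp {i : X ⟶ Y} {φ : M →ₗ[k] N} {g : ∀ p q, (X.col p).X q →ₗ[k] M}
    {g' : ∀ p q, (Y.col p).X q →ₗ[k] N} (h : ∀ p q x, φ (g p q x) = g' p q (app i p q x))
    (p : ℕ) (q : ℤ) (x : (X.col p).X q) : φ (compDv g p q x) = compDv g' p q (app i p q x) := by
  change φ (g p (q - 1) ((X.col p).d q (q - 1) x)) =
    g' p (q - 1) ((Y.col p).d q (q - 1) (app i p q x))
  rw [h, app_dv_apply]

theorem cofreeLift_comp {i : X ⟶ Y} {φ : M →ₗ[k] N} {g : ∀ p q, (X.col p).X q →ₗ[k] M}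
    {g' : ∀ p q, (Y.col p).X q →ₗ[k] N} (h : ∀ p q x, φ (g p q x) = g' p q (app i p q x)) :
    cofreeLift g ≫ cofreeMap φ = i ≫ cofreeLift g' := by
  refine hom_ext _ _ fun p q => ?_
  ext x
  exact Prod.ext (h p q x) (Prod.ext (compDv_comp h p q x)
    (Prod.ext (compDh_comp h p q x) (compDh_comp (compDv_comp h) p q x)))

/-- The projection to the component in bidegree `(p, q)`. -/
noncomputable def component (X : BCh k) (p : ℕ) (q : ℤ) (a : ℕ) (b : ℤ) :
    (X.col a).X b →ₗ[k] (X.col p).X q :=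
  DirectSum.component k (ℕ × ℤ) (fun i => (X.col i.1).X i.2) (p, q) ∘ₗ X.flatOf a b

theorem component_self (X : BCh k) (p : ℕ) (q : ℤ) (x : (X.col p).X q) :
    X.component p q p q x = x :=
  X.flatOf_apply_self p q x

theorem component_app (f : X ⟶ Y) (p : ℕ) (q : ℤ) (a : ℕ) (b : ℤ) (x : (X.col a).X b) :
    Y.component p q a b (app f a b x) = app f p q (X.component p q a b x) := by
  by_cases h : (a, b) = (p, q)
  · obtain ⟨rfl, rfl⟩ := Prod.mk.inj h
    rw [component_self, component_self]
  · exact (Y.flatOf_apply_of_ne _ h).trans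
      ((congrArg (app f p q) (X.flatOf_apply_of_ne x h)).trans (map_zero _)).symm

/-- In each bidegree, a cofibration has the left lifting property with respect to surjections. -/
theorem exists_lift_of_llp {i : X ⟶ Y} (hi : (ITot k).rlp.llp i) {φ : M →ₗ[k] N}
    (hφ : Function.Surjective φ) (p : ℕ) (q : ℤ) (g : (X.col p).X q →ₗ[k] M)
    (g' : (Y.col p).X q →ₗ[k] N) (h : ∀ x, φ (g x) = g' (app i p q x)) :
    ∃ l : (Y.col p).X q →ₗ[k] M, (∀ x, l (app i p q x) = g x) ∧ ∀ y, φ (l y) = g' y := by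
  -- The family equal to g in bidegree (p, q) and zero elsewhere, so that the lifting problem of
  -- modules becomes one of bicomplexes.
  let G (a : ℕ) (b : ℤ) : (X.col a).X b →ₗ[k] M := g ∘ₗ X.component p q a b
  let G' (a : ℕ) (b : ℤ) : (Y.col a).X b →ₗ[k] N := g' ∘ₗ Y.component p q a b
  have sq : CommSq (cofreeLift G) i (cofreeMap φ) (cofreeLift G') := ⟨cofreeLift_comp (by
    intro a b x
    change φ (g _) = g' (Y.component p q a b _)
    rw [h, component_app])⟩
  have := hi (cofreeMap φ) ((itot_rlp_iff _).2 fun p => hasDiscLifting_cofreeMap hφ p)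
  refine ⟨LinearMap.fst k M (M × M × M) ∘ₗ (app sq.lift p q).hom, fun x => ?_, fun y => ?_⟩
  · refine (congrArg (fun u : X ⟶ cofree k M => LinearMap.fst k M (M × M × M)
      ((app u p q).hom x)) sq.fac_left).trans ?_
    exact congrArg g (X.component_self p q x)
  · refine (congrArg (fun u : Y ⟶ cofree k N => LinearMap.fst k N (N × N × N)
      ((app u p q).hom y)) sq.fac_right).trans ?_
    exact congrArg g' (Y.component_self p q y)

/-- Extending the identity of X_{p,q} along i, by lifting against X_{p,q} → 0, gives a retraction.
-/
theorem injective_of_llp {i : X ⟶ Y} (hi : (ITot k).rlp.llp i) (p : ℕ) (q : ℤ) :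
    Function.Injective (app i p q) := by
  obtain ⟨l, hl, -⟩ := exists_lift_of_llp hi
    (φ := (0 : (X.col p).X q →ₗ[k] PUnit.{u + 1})) (fun _ => ⟨0, rfl⟩) p q LinearMap.id 0
    (fun _ => rfl)
  exact Function.LeftInverse.injective hl

theorem projective_of_llp {Q : BCh k} (hQ : (ITot k).rlp.llp (initial.to Q)) (p : ℕ) (q : ℤ) :
    Module.Projective k ((Q.col p).X q) := by
  refine Module.Projective.of_lifting_property'' fun f hf => ?_
  obtain ⟨l, -, hl⟩ := exists_lift_of_llp hQ hf p q 0 LinearMap.id (by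
    intro x
    have : initial.to Q = 0 := initialIsInitial.hom_ext _ _
    rw [this, app_zero]
    exact map_zero f)
  exact ⟨l, LinearMap.ext hl⟩

end Cofree

/-! ### Cofibrations and their cokernels -/

section Cokernel

variable {X Y : BCh k}

theorem mono_of_llp {f : X ⟶ Y} (hf : (ITot k).rlp.llp f) : Mono f :=
  (mono_iff f).2 (injective_of_llp hf)

/-- The map from 0 to the cokernel is a pushout of f: a lift in the square with zero top map factors
through the cokernel. -/
theorem llp_initial_to_cokernel {T : MorphismProperty (BCh k)} {f : X ⟶ Y} (hf : T.llp f) :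
    T.llp (initial.to (cokernel f)) := by
  intro A B g hg
  refine ⟨fun {u v} sq => ?_⟩
  have := hf g hg
  have sq' : CommSq (0 : X ⟶ A) f g (cokernel.π f ≫ v) := ⟨by simp⟩
  refine ⟨⟨⟨cokernel.desc f sq'.lift sq'.fac_left, initialIsInitial.hom_ext _ _, ?_⟩⟩⟩
  rw [← cancel_epi (cokernel.π f), cokernel.π_desc_assoc, sq'.fac_right]

/-- A monomorphism whose cokernel has the left lifting property with respect to the trivial
fibrations has this lifting property itself. -/
theorem llp_of_llp_initial_to_cokernel {f : X ⟶ Y} [Mono f]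
    (hf : (ITot k).rlp.llp (initial.to (cokernel f))) : (ITot k).rlp.llp f := by
  intro A B g hg
  refine ⟨fun {u v} sq => ?_⟩
  -- With P the pullback of g and v, it suffices to find a section t of P → Y that restricts to s on
  -- X.
  let s : X ⟶ pullback g v := pullback.lift u f sq.w
  have hs : s ≫ pullback.snd g v = f := pullback.lift_snd _ _ _
  have : Mono s := mono_of_mono_fac hs
  have hsnd : (ITot k).rlp (pullback.snd g v) := MorphismProperty.pullback_snd g v hg
  have hsnd' := (itot_rlp_iff_quasiIso _).1 hsnd
  have : Epi (pullback.snd g v) := (epi_iff _).2 hsnd'.1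
  let r : cokernel s ⟶ cokernel f := cokernel.map s f (𝟙 X) (pullback.snd g v) (by simp [hs])
  have hr : cokernel.π s ≫ r = pullback.snd g v ≫ cokernel.π f := cokernel.π_desc _ _ _
  have : Epi r := by
    have : Epi (cokernel.π s ≫ r) := by rw [hr]; infer_instance
    exact epi_of_epi (cokernel.π s) r
  -- P → Y is a trivial fibration; comparing the columns of X → P → coker s and X → Y → coker f
  -- makes r one too. Cofibrancy of coker f then gives a section of r.
  have hr' : (ITot k).rlp r := by
    refine (itot_rlp_iff_quasiIso r).2 ⟨(epi_iff r).1 inferInstance, fun p => ?_⟩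
    let φ : ShortComplex.mk _ _ (cokernel.condition s) ⟶
        ShortComplex.mk _ _ (cokernel.condition f) :=
      { τ₁ := 𝟙 X, τ₂ := pullback.snd g v, τ₃ := r, comm₁₂ := by simp [hs], comm₂₃ := hr.symm }
    exact HomologicalComplex.HomologySequence.quasiIso_τ₃
      ((colFunctor k p).mapShortComplex.map φ) (shortExact_col (shortExact_cokernel s) p)
      (shortExact_col (shortExact_cokernel f) p)
      (inferInstanceAs (QuasiIso ((colFunctor k p).map (𝟙 X)))) (hsnd'.2 p)
  have := hf r hr'
  have sq₁ : CommSq (initial.to (cokernel s)) (initial.to (cokernel f)) r (𝟙 _) :=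
    ⟨initialIsInitial.hom_ext _ _⟩
  -- P is also the pullback of Y and coker s over coker f, so the section of r induces t.
  let m : pullback g v ⟶ pullback (cokernel.π f) r :=
    pullback.lift (pullback.snd g v) (cokernel.π s) hr.symm
  have hm₁ : m ≫ pullback.fst _ _ = pullback.snd g v := pullback.lift_fst _ _ _
  have hm₂ : m ≫ pullback.snd _ _ = cokernel.π s := pullback.lift_snd _ _ _
  have : Mono m := by
    refine Preadditive.mono_of_cancel_zero _ fun {T} z hz => ?_
    have h₁ : z ≫ pullback.snd g v = 0 := by rw [← hm₁, reassoc_of% hz, zero_comp]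
    have h₂ : z ≫ cokernel.π s = 0 := by rw [← hm₂, reassoc_of% hz, zero_comp]
    obtain ⟨x, hx⟩ := (shortExact_cokernel s).exact.lift' z h₂
    have hx' : x ≫ f = 0 := by rw [← hs, reassoc_of% hx, h₁]
    rw [← hx, zero_of_comp_mono f hx', zero_comp]
  -- Lift the coker s component to P; the discrepancy in Y dies in coker f, hence comes from some x
  -- in X, and subtracting s(x) repairs it.
  have : Epi m := by
    rw [epi_iff_surjective_up_to_refinements]
    intro T z
    obtain ⟨T', π, _, y, hy⟩ := surjective_up_to_refinements_of_epi (cokernel.π s)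
      (z ≫ pullback.snd _ _)
    obtain ⟨x, hx⟩ := (shortExact_cokernel f).exact.lift'
      (y ≫ pullback.snd g v - π ≫ z ≫ pullback.fst _ _) (by
        change (y ≫ pullback.snd g v - π ≫ z ≫ pullback.fst _ _) ≫ cokernel.π f = 0
        rw [Preadditive.sub_comp, Category.assoc, ← hr, ← reassoc_of% hy, Category.assoc,
          Category.assoc, pullback.condition, sub_self])
    change x ≫ f = _ at hx
    refine ⟨T', π, inferInstance, y - x ≫ s, pullback.hom_ext ?_ ?_⟩
    · simp only [Category.assoc, hm₁, Preadditive.sub_comp, hs, hx]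
      abel
    · simp only [Category.assoc, hm₂, Preadditive.sub_comp, cokernel.condition, comp_zero,
        sub_zero, hy]
  have : IsIso m := isIso_of_mono_of_epi m
  have hl : 𝟙 Y ≫ cokernel.π f = (cokernel.π f ≫ sq₁.lift) ≫ r := by
    rw [Category.assoc, sq₁.fac_right, Category.id_comp, Category.comp_id]
  let t : Y ⟶ pullback g v := pullback.lift (𝟙 Y) (cokernel.π f ≫ sq₁.lift) hl ≫ inv m
  have htm : t ≫ m = pullback.lift (𝟙 Y) (cokernel.π f ≫ sq₁.lift) hl := by
    rw [Category.assoc, IsIso.inv_hom_id, Category.comp_id]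
  have ht₁ : t ≫ pullback.snd g v = 𝟙 Y := by
    rw [← hm₁, ← Category.assoc, htm, pullback.lift_fst]
  have ht₂ : t ≫ cokernel.π s = cokernel.π f ≫ sq₁.lift := by
    rw [← hm₂, ← Category.assoc, htm, pullback.lift_snd]
  have ht₃ : f ≫ t = s := by
    rw [← cancel_mono m]
    refine pullback.hom_ext ?_ ?_
    · simp only [Category.assoc, hm₁, ht₁, hs, Category.comp_id]
    · simp only [Category.assoc, hm₂, ht₂, cokernel.condition, cokernel.condition_assoc, zero_comp]
  refine ⟨⟨⟨t ≫ pullback.fst g v, ?_, ?_⟩⟩⟩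
  · rw [reassoc_of% ht₃, pullback.lift_fst]
  · rw [Category.assoc, pullback.condition, reassoc_of% ht₁]

theorem itot_llp_iff (f : X ⟶ Y) :
    (ITot k).rlp.llp f ↔ Mono f ∧ (ITot k).rlp.llp (initial.to (cokernel f)) :=
  ⟨fun h => ⟨mono_of_llp h, llp_initial_to_cokernel h⟩,
    fun ⟨_, h⟩ => llp_of_llp_initial_to_cokernel h⟩

theorem itot_llp_of_jtot_llp {f : X ⟶ Y} (hf : (JTot k).rlp.llp f) : (ITot k).rlp.llp f :=
  MorphismProperty.antitone_llp itot_rlp_le_jtot_rlp _ hf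

/-- The cokernel inherits the lifting property. Lifting its identity through the fibration
`pathProj` contracts its total complex. -/
theorem quasiIso_of_jtot_llp {f : X ⟶ Y} (hf : (JTot k).rlp.llp f) : QuasiIso (Tot.map f) := by
  have := mono_of_llp (itot_llp_of_jtot_llp hf)
  rw [quasiIso_tot_iff_cokernel]
  let Q := cokernel f
  have := llp_initial_to_cokernel hf Q.pathProj ((jtot_rlp_iff _).2
    ⟨Q.pathProj_surjective 0, Q.hasDiscLifting_pathProj⟩)
  have sq : CommSq (initial.to Q.path) (initial.to Q) Q.pathProj (𝟙 Q) :=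
    ⟨initialIsInitial.hom_ext _ _⟩
  exact Q.acyclic_tot_of_section sq.lift sq.fac_right

end Cokernel

end BCh

/-! ### Smallness and local presentability. -/

namespace CategoryTheory

/-- A set of morphisms in a locally presentable category permits the small object argument. -/
theorem MorphismProperty.hasSmallObjectArgument_of_isLocallyPresentable
    {C : Type*} [Category.{u} C] [HasColimitsOfSize.{u, u} C] [IsLocallyPresentable.{u} C]
    (I : MorphismProperty C) [MorphismProperty.IsSmall.{u} I] :
    MorphismProperty.HasSmallObjectArgument.{u} I := by
  have h (X : C) : IsPresentable.{u} X := inferInstance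
  choose κ hκ hX using fun X => (h X).exists_cardinal
  -- One regular cardinal above the presentability ranks of the sources of all maps in I, possible
  -- because I is small.
  obtain ⟨κ', hκ', hlt⟩ := HasCardinalLT.exists_regular_cardinal_forall.{u}
    (fun f : I.toSet => (κ f.1.left).ord.ToType)
  have : Fact κ'.IsRegular := ⟨hκ'⟩
  have : Nonempty κ'.ord.ToType := by simpa using hκ'.ne_zero
  have := WellFoundedLT.toOrderBot κ'.ord.ToType
  refine ⟨κ', inferInstance, inferInstance, { preservesColimit := ?_ }⟩
  intro A B X Y i hi f hf
  have := hκ A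
  have hA : IsCardinalPresentable A (κ A) := hX A
  have hle : κ A ≤ κ' := le_of_lt (by
    simpa [hasCardinalLT_iff_cardinal_mk_lt] using hlt ⟨CategoryTheory.Arrow.mk i, hi⟩)
  have : IsCardinalPresentable A κ' := isCardinalPresentable_of_le A hle
  have := preservesColimitsOfShape_of_isCardinalPresentable A κ' κ'.ord.ToType
  infer_instance

instance MorphismProperty.isSmall_sup {C : Type*} [Category* C] (W₁ W₂ : MorphismProperty C)
    [MorphismProperty.IsSmall.{u} W₁] [MorphismProperty.IsSmall.{u} W₂] :
    MorphismProperty.IsSmall.{u} (W₁ ⊔ W₂) where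
  small_toSet := inferInstanceAs (Small.{u} (W₁.toSet ∪ W₂.toSet : Set (CategoryTheory.Arrow C)))

end CategoryTheory

namespace BCh

variable {k : Type u} [CommRing k]

/-- The functor taking the component in a given bidegree is corepresentable. -/
theorem exists_universal_element (p : ℕ) (q : ℤ) :
    ∃ (G : BCh k) (γ : (G.col p).X q), ∀ (X : BCh k) (x : (X.col p).X q),
      ∃! f : G ⟶ X, app f p q γ = x := by
  obtain ⟨q, rfl⟩ : ∃ q', q = q' + 1 := ⟨q - 1, by omega⟩
  cases p with
  | zero =>
    refine ⟨hBdDisc k 1 (q + 1), gen (𝟙 _) 0 (q + 1) ⟨rfl, Or.inl rfl⟩, fun X x => ?_⟩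
    obtain ⟨f, hf⟩ := exists_hBdDisc_hom q x
    exact ⟨f, hf, fun g hg => hBdDisc_hom_ext (hg.trans hf.symm)⟩
  | succ p =>
    refine ⟨disc k (p + 1) (q + 1), gen (𝟙 _) (p + 1) (q + 1) ⟨Or.inl rfl, Or.inl rfl⟩,
      fun X x => ?_⟩
    obtain ⟨f, hf⟩ := exists_disc_hom p q x
    exact ⟨f, hf, fun g hg => disc_hom_ext (hg.trans hf.symm)⟩

attribute [local instance] Cardinal.fact_isRegular_aleph0

/-- Hom(G, -) is the underlying set of the component in bidegree (p, q). Evaluation preserves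
colimits, and the forgetful functor of modules preserves filtered ones. -/
theorem isCardinalPresentable_of_universal_element {p : ℕ} {q : ℤ} {G : BCh k} (γ : (G.col p).X q)
    (h : ∀ (X : BCh k) (x : (X.col p).X q), ∃! f : G ⟶ X, app f p q γ = x) :
    IsCardinalPresentable G Cardinal.aleph0.{u} := by
  let e : evalFunctor k p q ⋙ forget (ModuleCat.{u} k) ≅ coyoneda.obj (Opposite.op G) :=
    (NatIso.ofComponents (fun X => Equiv.toIso (Equiv.ofBijective
      (fun f : G ⟶ X => (app f p q γ : (X.col p).X q))
      ⟨fun f g hfg => (h X _).unique hfg rfl, fun x => (h X x).exists⟩))).symm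
  have : (forget (ModuleCat.{u} k)).IsCardinalAccessible Cardinal.aleph0.{u} := by
    constructor
    intro J _ _
    have := isFiltered_of_isCardinalFiltered J Cardinal.aleph0.{u}
    infer_instance
  have : (evalFunctor k p q ⋙ forget (ModuleCat.{u} k)).IsCardinalAccessible Cardinal.aleph0.{u} :=
    inferInstance
  exact Functor.isCardinalAccessible_of_natIso e _

/-- The corepresenting objects see every element. They therefore separate morphisms, and a
monomorphism through which all their maps factor is surjective, hence an isomorphism. -/
instance : IsLocallyPresentable.{u} (BCh k) where
  exists_cardinal := by
    refine ⟨Cardinal.aleph0, inferInstance, ?_⟩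
    rw [IsCardinalLocallyPresentable.iff_exists_isStrongGenerator]
    choose G γ h using exists_universal_element (k := k)
    refine ⟨ObjectProperty.ofObj fun i : ℕ × ℤ => G i.1 i.2, inferInstance, ?_, ?_⟩
    · rw [ObjectProperty.isStrongGenerator_iff]
      refine ⟨fun X Y f g H => hom_ext _ _ fun p q => ?_, fun X Y i _ H => ?_⟩
      · ext x
        obtain ⟨φ, rfl, -⟩ := h p q X x
        exact congrArg (fun ψ => app ψ p q (γ p q)) (H _ ⟨(p, q)⟩ φ)
      · have : Epi i := by
          refine (epi_iff i).2 fun p q y => ?_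
          obtain ⟨φ, rfl, -⟩ := h p q Y y
          obtain ⟨ψ, rfl⟩ := H _ ⟨(p, q)⟩ φ
          exact ⟨app ψ p q (γ p q), rfl⟩
        exact isIso_of_mono_of_epi i
    · rintro _ ⟨p, q⟩
      exact isCardinalPresentable_of_universal_element _ (h p q)

instance : MorphismProperty.IsSmall.{u} (ITot k) :=
  have := MorphismProperty.isSmall_ofHoms.{u} (fun q : ℤ => sphereIncl k q)
  have := MorphismProperty.isSmall_ofHoms.{u}
    (fun i : {p : ℕ // 0 < p} × ℤ => vBdDiscIncl k i.1.1 i.2)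
  MorphismProperty.isSmall_sup _ _

instance : MorphismProperty.IsSmall.{u} (JTot k) :=
  have := MorphismProperty.isSmall_ofHoms.{u} (fun q : ℤ => fromZero k (hBdDisc k 1 q))
  have := MorphismProperty.isSmall_ofHoms.{u}
    (fun i : {p : ℕ // 0 < p} × ℤ => vBdDiscIncl k i.1.1 i.2)
  MorphismProperty.isSmall_sup _ _

instance : MorphismProperty.HasSmallObjectArgument.{u} (ITot k) :=
  MorphismProperty.hasSmallObjectArgument_of_isLocallyPresentable _

instance : MorphismProperty.HasSmallObjectArgument.{u} (JTot k) :=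
  MorphismProperty.hasSmallObjectArgument_of_isLocallyPresentable _

end BCh

namespace HomologicalComplex

theorem acyclic_iff_of_iso {C ι : Type*} [Category* C] [HasZeroMorphisms C] {c : ComplexShape ι}
    {K L : HomologicalComplex C c} (e : K ≅ L) : K.Acyclic ↔ L.Acyclic :=
  ⟨fun h i => (h i).of_iso e, fun h i => (h i).of_iso e.symm⟩

end HomologicalComplex

namespace BCh

variable {k : Type u} [CommRing k]

/-! ### The total model structure -/

variable (k) in
/-- The morphisms which become quasi-isomorphisms on total complexes. -/
def totQuasiIso : MorphismProperty (BCh k) :=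
  (HomologicalComplex.quasiIso (ModuleCat.{u} k) (ComplexShape.down ℤ)).inverseImage Tot

theorem totQuasiIso_iff {X Y : BCh k} (f : X ⟶ Y) :
    totQuasiIso k f ↔ QuasiIso (Tot.map f) :=
  HomologicalComplex.mem_quasiIso_iff _

instance : (totQuasiIso k).HasTwoOutOfThreeProperty := by
  unfold totQuasiIso
  infer_instance

theorem itot_rlp_eq : (ITot k).rlp = (JTot k).rlp ⊓ totQuasiIso k := by
  ext X Y f
  exact (itot_rlp_iff_jtot_rlp_and_quasiIso f).trans (and_congr_right' (totQuasiIso_iff f).symm)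

/-- Retract argument: factor f through `JTot`. By two-out-of-three the second factor is a trivial
fibration, so f lifts against it and is a retract of the first factor. -/
theorem jtot_llp_eq : (JTot k).rlp.llp = (ITot k).rlp.llp ⊓ totQuasiIso k := by
  refine le_antisymm (fun X Y f hf =>
    ⟨itot_llp_of_jtot_llp hf, (totQuasiIso_iff f).2 (quasiIso_of_jtot_llp hf)⟩) ?_
  rintro X Y f ⟨hf, hf'⟩
  let d := MorphismProperty.factorizationData (JTot k).rlp.llp (JTot k).rlp f
  have hi : totQuasiIso k d.i := (totQuasiIso_iff _).2 (quasiIso_of_jtot_llp d.hi)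
  have hp : (ITot k).rlp d.p := by
    rw [itot_rlp_eq]
    exact ⟨d.hp, (totQuasiIso k).of_precomp _ _ hi (by rwa [d.fac])⟩
  have := hf d.p hp
  exact MorphismProperty.of_retract (RetractArrow.ofLeftLiftingProperty d.fac) d.hi

noncomputable scoped instance : ModelCategory (BCh k) :=
  letI : CategoryWithFibrations (BCh k) := ⟨(JTot k).rlp⟩
  letI : CategoryWithCofibrations (BCh k) := ⟨(ITot k).rlp.llp⟩
  letI : CategoryWithWeakEquivalences (BCh k) := ⟨totQuasiIso k⟩
  have : HasFiniteColimits (BCh k) := inferInstance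
  have : (weakEquivalences (BCh k)).HasTwoOutOfThreeProperty :=
    inferInstanceAs (totQuasiIso k).HasTwoOutOfThreeProperty
  have : (cofibrations (BCh k)).IsWeakFactorizationSystem (trivialFibrations (BCh k)) := by
    change (ITot k).rlp.llp.IsWeakFactorizationSystem ((JTot k).rlp ⊓ totQuasiIso k)
    rw [← itot_rlp_eq]
    exact { rlp := (ITot k).rlp_llp_rlp, llp := rfl }
  have : (trivialCofibrations (BCh k)).IsWeakFactorizationSystem (fibrations (BCh k)) := by
    change ((ITot k).rlp.llp ⊓ totQuasiIso k).IsWeakFactorizationSystem (JTot k).rlp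
    rw [← jtot_llp_eq]
    exact { rlp := (JTot k).rlp_llp_rlp, llp := rfl }
  ModelCategory.mk' (BCh k)

section

variable {X Y : BCh k} (f : X ⟶ Y)

theorem weakEquivalence_iff_quasiIso : WeakEquivalence f ↔ QuasiIso (Tot.map f) :=
  (weakEquivalence_iff f).trans (totQuasiIso_iff f)

theorem fibrations_eq : fibrations (BCh k) = (JTot k).rlp := rfl

theorem trivialFibrations_eq : trivialFibrations (BCh k) = (ITot k).rlp :=
  itot_rlp_eq.symm

theorem cofibrations_eq : cofibrations (BCh k) = (ITot k).rlp.llp := rfl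

theorem fibration_iff_quasiIso : Fibration f ↔
    (∀ p q, Function.Surjective (app f p q)) ∧ ∀ p, 0 < p → QuasiIso (Hom.f f p) :=
  (fibration_iff f).trans (jtot_rlp_iff_quasiIso f)

theorem cofibration_iff_mono : Cofibration f ↔ Mono f ∧ IsCofibrant (cokernel f) := by
  rw [isCofibrant_iff, cofibration_iff, cofibration_iff, cofibrations_eq]
  exact itot_llp_iff f

/-- The initial map is zero and monic, so its cokernel is X itself. -/
theorem weakEquivalence_initial_to_iff (X : BCh k) :
    WeakEquivalence (initial.to X) ↔ (Tot.obj X).Acyclic := by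
  have h : initial.to X = 0 := initialIsInitial.hom_ext _ _
  rw [weakEquivalence_iff_quasiIso, quasiIso_tot_iff_cokernel]
  exact HomologicalComplex.acyclic_iff_of_iso
    (Tot.mapIso (cokernelIsoOfEq h ≪≫ cokernelZeroIsoTarget))

instance (X : BCh k) : Epi (terminal.from X) :=
  ((IsZero.iff_id_eq_zero _).2 (terminalIsTerminal.hom_ext _ _)).epi _

theorem weakEquivalence_terminal_from_iff (X : BCh k) :
    WeakEquivalence (terminal.from X) ↔ (Tot.obj X).Acyclic := by
  have h : terminal.from X = 0 := terminalIsTerminal.hom_ext _ _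
  rw [weakEquivalence_iff_quasiIso, quasiIso_tot_iff_kernel]
  exact HomologicalComplex.acyclic_iff_of_iso
    (Tot.mapIso (kernelIsoOfEq h ≪≫ kernelZeroIsoSource))

theorem isFibrant_iff_acyclic (X : BCh k) :
    IsFibrant X ↔ ∀ p, 0 < p → (X.col p).Acyclic := by
  have h : terminal.from X = 0 := terminalIsTerminal.hom_ext _ _
  rw [isFibrant_iff, fibration_iff_quasiIso, ← epi_iff,
    and_iff_right (inferInstanceAs (Epi (terminal.from X)))]
  refine forall₂_congr fun p _ => (quasiIso_col_iff_kernel _ p).trans ?_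
  exact HomologicalComplex.acyclic_iff_of_iso
    ((colFunctor k p).mapIso (kernelIsoOfEq h ≪≫ kernelZeroIsoSource))

theorem fibration_iff_epi : Fibration f ↔ Epi f ∧ IsFibrant (kernel f) := by
  rw [fibration_iff_quasiIso, ← epi_iff, isFibrant_iff_acyclic]
  refine and_congr_right fun _ => ?_
  simp only [quasiIso_col_iff_kernel]

end

/-- Cofibrations are monic and pushout preserves their cokernels; fibrations are epic and pullback
preserves their kernels. The five lemma for the long exact sequences of Tot does the rest. -/
theorem isProperModel : IsProperModel (BCh k) where
  left {A B X Y i w w' j} sq hi hw := by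
    rw [weakEquivalence_iff_quasiIso] at hw ⊢
    have hi' := (cofibration_iff_mono i).1 hi |>.1
    have hj := (cofibration_iff_mono j).1 ((cofibration_iff j).2
      (MorphismProperty.of_isPushout sq.flip ((cofibration_iff i).1 hi))) |>.1
    let φ : ShortComplex.mk _ _ (cokernel.condition i) ⟶
        ShortComplex.mk _ _ (cokernel.condition j) :=
      { τ₁ := w, τ₂ := w', τ₃ := cokernel.map _ _ _ _ sq.w
        comm₁₂ := sq.w.symm, comm₂₃ := by simp }
    have : IsIso (cokernel.map i j w w' sq.w) := isIso_cokernel_map_of_isPushout sq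
    exact HomologicalComplex.HomologySequence.quasiIso_τ₂ (Tot.mapShortComplex.map φ)
      (shortExact_tot (shortExact_cokernel i)) (shortExact_tot (shortExact_cokernel j)) hw
      (inferInstanceAs (QuasiIso (Tot.map (cokernel.map i j w w' sq.w))))
  right {A B X Y w' q p w} sq hp hw := by
    rw [weakEquivalence_iff_quasiIso] at hw ⊢
    have hp' := (fibration_iff_epi p).1 hp |>.1
    have hq := (fibration_iff_epi q).1 ((fibration_iff q).2
      (MorphismProperty.of_isPullback sq ((fibration_iff p).1 hp))) |>.1
    let φ : ShortComplex.mk _ _ (kernel.condition q) ⟶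
        ShortComplex.mk _ _ (kernel.condition p) :=
      { τ₁ := kernel.map _ _ _ _ sq.w.symm, τ₂ := w', τ₃ := w
        comm₁₂ := by simp, comm₂₃ := sq.w }
    have : IsIso (kernel.map q p w' w sq.w.symm) := isIso_kernel_map_of_isPullback sq.flip
    exact HomologicalComplex.HomologySequence.quasiIso_τ₂ (Tot.mapShortComplex.map φ)
      (shortExact_tot (shortExact_kernel q)) (shortExact_tot (shortExact_kernel p))
      (inferInstanceAs (QuasiIso (Tot.map (kernel.map q p w' w sq.w.symm)))) hw

/-- A monomorphism is a weak equivalence exactly when Tot of its cokernel is acyclic, and dually for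
an epimorphism and its kernel. -/
theorem isAbelianModel : IsAbelianModel (BCh k) where
  cofibration_iff := cofibration_iff_mono
  trivialCofibration_iff f := by
    rw [mem_trivialCofibrations_iff, cofibration_iff_mono, weakEquivalence_iff_quasiIso, and_assoc]
    refine and_congr_right fun _ => ?_
    rw [quasiIso_tot_iff_cokernel, weakEquivalence_initial_to_iff]
  fibration_iff := fibration_iff_epi
  trivialFibration_iff f := by
    rw [mem_trivialFibrations_iff, fibration_iff_epi, weakEquivalence_iff_quasiIso, and_assoc]
    refine and_congr_right fun _ => ?_
    rw [quasiIso_tot_iff_kernel, weakEquivalence_terminal_from_iff]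

theorem isCofibrantlyGeneratedBy : IsCofibrantlyGeneratedBy.{u} (ITot k) (JTot k) where
  small_I := inferInstance
  small_J := inferInstance
  fibrations_eq := fibrations_eq
  trivialFibrations_eq := trivialFibrations_eq

end BCh

theorem theorem3p1 (k : Type u) [CommRing k] :
    ∃ (_ : Abelian (BCh k)) (_ : ModelCategory (BCh k)),
      -- the underlying category is bicomplete; the model structure is proper, combinatorial, abelian
      HasLimitsOfSize.{u, u} (BCh k) ∧ HasColimitsOfSize.{u, u} (BCh k) ∧
      IsProperModel (BCh k) ∧ IsCombinatorialModel.{u} (BCh k) ∧ IsAbelianModel (BCh k) ∧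
      -- weak equivalences
      (∀ {X Y : BCh k} (f : X ⟶ Y), WeakEquivalence f ↔ QuasiIso (BCh.Tot.map f)) ∧
      -- fibrations
      (∀ {X Y : BCh k} (f : X ⟶ Y), Fibration f ↔
        (∀ p q, Function.Surjective (BCh.app f p q)) ∧
          ∀ p, 0 < p → ∀ q, IsIso (BCh.vHomologyMap f p q)) ∧
      -- trivial fibrations
      (∀ {X Y : BCh k} (f : X ⟶ Y), trivialFibrations (BCh k) f ↔
        (∀ p q, Function.Surjective (BCh.app f p q)) ∧
          ∀ p q, IsIso (BCh.vHomologyMap f p q)) ∧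
      -- cofibrations
      (∀ {X Y : BCh k} (f : X ⟶ Y), Cofibration f ↔
        (∀ p q, Function.Injective (BCh.app f p q)) ∧ IsCofibrant (cokernel f)) ∧
      (∀ X : BCh k, IsCofibrant X → ∀ p q, Module.Projective k ((X.col p).X q)) ∧
      -- generating cofibrations and generating trivial cofibrations
      IsCofibrantlyGeneratedBy.{u} (BCh.ITot k) (BCh.JTot k) := by
  open BCh in
  refine ⟨inferInstance, inferInstance, inferInstance, inferInstance, isProperModel,
    ⟨inferInstance, _, _, isCofibrantlyGeneratedBy⟩, isAbelianModel,
    fun f => weakEquivalence_iff_quasiIso f, fun f => ?_, fun f => ?_, fun f => ?_,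
    fun X hX => projective_of_llp ((cofibration_iff _).1 hX), isCofibrantlyGeneratedBy⟩
  · simpa only [BCh.quasiIso_col_iff] using BCh.fibration_iff_quasiIso f
  · rw [BCh.trivialFibrations_eq, BCh.itot_rlp_iff_quasiIso]
    simp only [BCh.quasiIso_col_iff]
  · rw [BCh.cofibration_iff_mono, BCh.mono_iff]
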